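/- **Property graphs and GPC.** A property graph consists of finite disjoint sets $N$ (nodes) and $E$ (directed edges) of identifiers, maps $\mathsf{src},\mathsf{tgt}:E\to N$, a finite set of labels for each element of $N\cup E$, and a partial function $\delta$ with finite domain that gives elements values (constants) for keys. Variables, labels, keys and constants are named by finite binary strings. Path patterns of the Graph Pattern Calculus (GPC) are generated by $$\pi ::= (x:\ell)\mid \xrightarrow{x:\ell}\mid\xleftarrow{x:\ell}\mid \pi+\pi\mid\pi\,\pi\mid\pi_{\langle\theta\rangle}\mid\pi^{n..m}\qquad(n\in\mathbb N,\ m\in\mathbb N\cup\{\infty\}),$$ where the variable $x$ and the label $\ell$ are optional, and conditions by $\theta ::= x.a=c\mid x.a=y.b\mid\theta\wedge\theta\mid\theta\vee\theta\mid\neg\theta$; an equality holds if both sides are defined and equal. A GPC pattern (query) is a path pattern $\rho\,\pi$ qualified with a restrictor $\rho\in\{\mathsf{simple},\mathsf{trail},\mathsf{shortest}\}$, or a join $Q_1,Q_2$ of queries, or a query $Q_{\langle\theta\rangle}$ with a condition. The restrictor $\mathsf{simple}$ keeps the matching paths without a repeated node, $\mathsf{trail}$ those without a repeated edge, and $\mathsf{shortest}$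 those of minimal length among the matching paths of $\pi$ with the same endpoints. Queries are required to be well-typed: the typing rules of GPC give each variable a unique type among $\mathsf{Node}$, $\mathsf{Edge}$, $\mathsf{Maybe}(\tau)$ (variables that may be unbound because of a union) and $\mathsf{Group}(\tau)$ (variables under a repetition); only variables of type $\mathsf{Node}$ or $\mathsf{Edge}$ (singleton variables) may occur in conditions or be shared by the two parts of a concatenation or a join. The answers to a query on a property graph are the bindings of its singleton variables that result from its matches. A query is *satisfiable* if its set of answers on some property graph is non-empty. **Lemma.** The following problem is $\mathrm{PSPACE}$-hard: given a well-typed GPC query, written as a word over a finite alphabet, decide whether it is satisfiable. Moreover, for each single restrictor $\rho\in\{\mathsf{simple},\mathsf{trail},\mathsf{shortest}\}$ the problem remains $\mathrm{PSPACE}$-hard when the input is restricted to well-typed queries of the form $\rho\,\pi$ with $\pi$ a path pattern. Here a problem is $\mathrm{PSPACE}$-hard if for every language $L$ over a finite alphabet that is decided by a deterministic Turing machine in space polynomial in the length of the input there is a function $f$, computable by a Turing machine in polynomial time, that maps words to instances of the problem, such that $w\in L$ if and only if the answer for $f(w)$ is yes. -/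

import Mathlib

/-! ### Languages in PSPACE: deterministic one-tape Turing machines -/

namespace Complexity

/-- Head movements. -/
inductive Move
  | left
  | stay
  | right
  deriving DecidableEq

/-- A deterministic Turing machine with one tape, infinite to the right, over the finite input
alphabet `A`. It halts in the state `q` reading `a` when `trans q a = none`. -/
structure TuringMachine (A : Type) where
  State : Type
  [finState : Fintype State]
  Symbol : Type
  [finSymbol : Fintype Symbol]
  input : A → Symbol
  input_injective : Function.Injective input
  blank : Symbol
  input_ne_blank : ∀ a, input a ≠ blank
  start : State
  accepting : Set State
  trans : State → Symbol → Option (State × Symbol × Move)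

/-- A configuration: state, head position and tape content. -/
structure Configuration (State Symbol : Type) where
  state : State
  head : ℕ
  tape : ℕ → Symbol

/-- The head position after a move; on the leftmost cell, a move to the left has no effect. -/
def Move.apply : Move → ℕ → ℕ
  | .left, i => i - 1
  | .stay, i => i
  | .right, i => i + 1

namespace TuringMachine

variable {A : Type}

/-- Initially the word `w` stands on the cells `0, …, |w| - 1`, all other cells are blank and the
head is on cell `0`. -/
def init (M : TuringMachine A) (w : List A) : Configuration M.State M.Symbol where
  state := M.start
  head := 0
  tape i := (w[i]?).elim M.blank M.input

/-- One computation step (`none` if the machine halts). -/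
def step (M : TuringMachine A) (c : Configuration M.State M.Symbol) :
    Option (Configuration M.State M.Symbol) :=
  (M.trans c.state (c.tape c.head)).map fun t =>
    { state := t.1
      head := t.2.2.apply c.head
      tape := Function.update c.tape c.head t.2.1 }

/-- The machine halts on `w`. -/
def Halts (M : TuringMachine A) (w : List A) : Prop :=
  ∃ c, StateTransition.Reaches M.step (M.init w) c ∧ M.step c = none

/-- The machine halts on `w` in an accepting state. -/
def Accepts (M : TuringMachine A) (w : List A) : Prop :=
  ∃ c, StateTransition.Reaches M.step (M.init w) c ∧ M.step c = none ∧ c.state ∈ M.accepting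

/-- On every input `w` the machine visits only cells among the first `s |w|` ones. -/
def RunsInSpace (M : TuringMachine A) (s : ℕ → ℕ) : Prop :=
  ∀ w c, StateTransition.Reaches M.step (M.init w) c → c.head < s w.length

end TuringMachine

/-- The class PSPACE: languages decided by a deterministic Turing machine whose space is bounded
by a polynomial in the length of the input. -/
def InPSPACE {A : Type} (L : Language A) : Prop :=
  ∃ (M : TuringMachine A) (p : Polynomial ℕ),
    M.RunsInSpace (fun n => p.eval n) ∧ (∀ w, M.Halts w) ∧ ∀ w, M.Accepts w ↔ w ∈ L

/-- A decision problem: instances, encoded as words over a finite alphabet, and the set of those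
instances for which the answer is yes. -/
structure DecisionProblem where
  Instance : Type
  Alphabet : Type
  [finAlphabet : Fintype Alphabet]
  encoding : Computability.Encoding Instance Alphabet
  yes : Set Instance

/-- Polynomial-time many-one reducibility of a language to a decision problem. The reduction is
computed by a Turing machine that runs in polynomial time. -/
def PolyTimeReducible {A : Type} (L : Language A) (P : DecisionProblem) : Prop :=
  ∃ f : List A → P.Instance,
    Nonempty (Turing.TM2ComputableInPolyTime (id : List A → List A) P.encoding.encode f) ∧
    ∀ w, w ∈ L ↔ f w ∈ P.yes

/-- A decision problem is PSPACE-hard if every language in PSPACE is reducible to it in polynomial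
time. -/
def PSPACEHard (P : DecisionProblem) : Prop :=
  ∀ (A : Type) [Fintype A] (L : Language A), InPSPACE L → PolyTimeReducible L P

end Complexity

/-! ### The graph pattern calculus -/

namespace GPC

/-- Names are finite binary strings; variables, labels, keys and constants are named by them. -/
abbrev Name := List Bool
/-- Variables. -/
abbrev Var := Name
/-- Labels. -/
abbrev Label := Name
/-- Keys (property names). -/
abbrev Key := Name
/-- Constants (data values). -/
abbrev Const := Name
/-- Object identifiers. -/
abbrev Ident := ℕ

/-- Property graphs. Only the values of `lab`, `src` and `tgt` on elements of the graph matter. -/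
structure PropertyGraph where
  nodes : Finset Ident
  edges : Finset Ident
  disjoint : Disjoint nodes edges
  lab : Ident → Finset Label
  src : Ident → Ident
  tgt : Ident → Ident
  src_mem : ∀ e ∈ edges, src e ∈ nodes
  tgt_mem : ∀ e ∈ edges, tgt e ∈ nodes
  prop : Ident → Key → Option Const
  prop_dom : ∀ o k, prop o k ≠ none → o ∈ nodes ∪ edges
  prop_finite : {ok : Ident × Key | prop ok.1 ok.2 ≠ none}.Finite

/-! #### Grammar -/

/-- What may be written in a node or an edge pattern: an optional variable, an optional label. -/
structure Descriptor where
  var : Option Var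
  label : Option Label

/-- The direction of an edge pattern. -/
inductive Direction
  | forward
  | backward

/-- Conditions: `x.a = c`, `x.a = y.b`, and Boolean combinations. -/
inductive Condition
  | eqConst (x : Var) (a : Key) (c : Const)
  | eqProp (x : Var) (a : Key) (y : Var) (b : Key)
  | and (θ₁ θ₂ : Condition)
  | or (θ₁ θ₂ : Condition)
  | not (θ : Condition)

/-- Path patterns. In `rep π n m` the upper bound `m = none` stands for `∞`. -/
inductive Pattern
  | node (d : Descriptor)
  | edge (dir : Direction) (d : Descriptor)
  | union (π₁ π₂ : Pattern)
  | concat (π₁ π₂ : Pattern)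
  | cond (π : Pattern) (θ : Condition)
  | rep (π : Pattern) (n : ℕ) (m : Option ℕ)

/-- Restrictors. -/
inductive Restrictor
  | simple
  | trail
  | shortest

/-- Queries (graph patterns): path patterns qualified with a restrictor, joins, and conditioning on
top of them. -/
inductive Query
  | path (ρ : Restrictor) (π : Pattern)
  | join (Q₁ Q₂ : Query)
  | cond (Q : Query) (θ : Condition)

/-! #### Types -/

/-- The types of variables. -/
inductive Ty
  | node
  | edge
  | maybe (τ : Ty)
  | group (τ : Ty)
  deriving DecidableEq

/-- Types of singleton variables. -/
def Ty.IsSingleton (τ : Ty) : Prop := τ = .node ∨ τ = .edge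

instance (τ : Ty) : Decidable τ.IsSingleton := by unfold Ty.IsSingleton; infer_instance

/-- `Maybe(τ)`, but not nested. -/
def Ty.optional : Ty → Ty
  | .maybe τ => .maybe τ
  | τ => .maybe τ

/-- The type of a variable in a union, given its types in the two operands (`none`: the variable
does not occur, or has no type). -/
def Ty.union : Option Ty → Option Ty → Option Ty
  | none, none => none
  | some τ, none => some τ.optional
  | none, some τ => some τ.optional
  | some τ₁, some τ₂ =>
    if τ₁ = τ₂ then some τ₁
    else if τ₂ = .maybe τ₁ then some τ₂
    else if τ₁ = .maybe τ₂ then some τ₁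
    else none

/-- A schema associates types with variables. -/
abbrev Schema := Var → Option Ty

/-- Two expressions can be concatenated or joined if the variables that they share are singletons of
the same type in both. -/
def Schema.Joinable (s₁ s₂ : Schema) : Prop :=
  ∀ x τ₁ τ₂, s₁ x = some τ₁ → s₂ x = some τ₂ → τ₁ = τ₂ ∧ τ₁.IsSingleton

/-- A variable is a singleton variable for a schema. -/
def Schema.Singleton (s : Schema) (x : Var) : Prop := ∃ τ, s x = some τ ∧ τ.IsSingleton

/-- A condition is well-typed if it only mentions singleton variables. -/
def Condition.WellTyped (s : Schema) : Condition → Prop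
  | .eqConst x _ _ => s.Singleton x
  | .eqProp x _ y _ => s.Singleton x ∧ s.Singleton y
  | .and θ₁ θ₂ => θ₁.WellTyped s ∧ θ₂.WellTyped s
  | .or θ₁ θ₂ => θ₁.WellTyped s ∧ θ₂.WellTyped s
  | .not θ => θ.WellTyped s

/-- The variables of a pattern. -/
def Pattern.vars : Pattern → Finset Var
  | .node d => d.var.toFinset
  | .edge _ d => d.var.toFinset
  | .union π₁ π₂ => π₁.vars ∪ π₂.vars
  | .concat π₁ π₂ => π₁.vars ∪ π₂.vars
  | .cond π _ => π.vars
  | .rep π _ _ => π.vars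

/-- The types that the variables have in a pattern. -/
def Pattern.sch : Pattern → Schema
  | .node d => fun x => if d.var = some x then some .node else none
  | .edge _ d => fun x => if d.var = some x then some .edge else none
  | .union π₁ π₂ => fun x => Ty.union (π₁.sch x) (π₂.sch x)
  | .concat π₁ π₂ => fun x => (π₁.sch x).or (π₂.sch x)
  | .cond π _ => π.sch
  | .rep π _ _ => fun x => (π.sch x).map .group

/-- Well-typed patterns. -/
def Pattern.WellTyped : Pattern → Prop
  | .node _ => True
  | .edge _ _ => True
  | .union π₁ π₂ => π₁.WellTyped ∧ π₂.WellTyped ∧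
      ∀ x ∈ π₁.vars ∪ π₂.vars, Ty.union (π₁.sch x) (π₂.sch x) ≠ none
  | .concat π₁ π₂ => π₁.WellTyped ∧ π₂.WellTyped ∧ π₁.sch.Joinable π₂.sch
  | .cond π θ => π.WellTyped ∧ θ.WellTyped π.sch
  | .rep π _ _ => π.WellTyped

/-- The types that the variables have in a query. -/
def Query.sch : Query → Schema
  | .path _ π => π.sch
  | .join Q₁ Q₂ => fun x => (Q₁.sch x).or (Q₂.sch x)
  | .cond Q _ => Q.sch

/-- Well-typed queries. -/
def Query.WellTyped : Query → Prop
  | .path _ π => π.WellTyped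
  | .join Q₁ Q₂ => Q₁.WellTyped ∧ Q₂.WellTyped ∧ Q₁.sch.Joinable Q₂.sch
  | .cond Q θ => Q.WellTyped ∧ θ.WellTyped Q.sch

/-! #### Semantics -/

/-- A path `(n₀, e₁, n₁, …, e_k, n_k)`: its first node `n₀` and the list of the `(e_i, n_i)`. -/
structure Path where
  src : Ident
  steps : List (Ident × Ident)

namespace Path

/-- The nodes `n₀, …, n_k`. -/
def nodes (p : Path) : List Ident := p.src :: p.steps.map Prod.snd

/-- The edges `e₁, …, e_k`. -/
def edges (p : Path) : List Ident := p.steps.map Prod.fst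

/-- The last node. -/
def tgt (p : Path) : Ident := p.nodes.getLast (List.cons_ne_nil _ _)

/-- The number of edges. -/
def length (p : Path) : ℕ := p.steps.length

/-- Concatenation, meaningful if `p.tgt = q.src`. -/
def append (p q : Path) : Path := ⟨p.src, p.steps ++ q.steps⟩

end Path

/-- Values of variables: nodes, edges, `nothing` (for types `Maybe(τ)`), and lists of values (for
types `Group(τ)`). -/
inductive Value
  | node (o : Ident)
  | edge (o : Ident)
  | nothing
  | group (vs : List Value)

/-- Assignments (partial functions). -/
abbrev Assignment := Var → Option Value

namespace Assignment

/-- The assignment that binds the variable, if there is one. -/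
def single (x : Option Var) (v : Value) : Assignment := fun y => if x = some y then some v else none

/-- Two assignments agree on their common variables. -/
def Compatible (μ₁ μ₂ : Assignment) : Prop :=
  ∀ x v₁ v₂, μ₁ x = some v₁ → μ₂ x = some v₂ → v₁ = v₂

/-- The union of two compatible assignments. -/
def union (μ₁ μ₂ : Assignment) : Assignment := fun x => (μ₁ x).or (μ₂ x)

/-- Bind the variables of `X` that are not yet bound to `nothing`. -/
def complete (X : Finset Var) (μ : Assignment) : Assignment :=
  fun x => (μ x).or (if x ∈ X then some .nothing else none)

/-- Bind each variable of `X` to the list of its values in the given assignments. -/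
def collect (X : Finset Var) (l : List Assignment) : Assignment :=
  fun x => if x ∈ X then some (.group (l.filterMap fun μ => μ x)) else none

/-- The value of the property `x.a`, if it is defined. -/
def prop (G : PropertyGraph) (μ : Assignment) (x : Var) (a : Key) : Option Const :=
  match μ x with
  | some (.node o) => G.prop o a
  | some (.edge o) => G.prop o a
  | _ => none

end Assignment

/-- Truth of a condition; an equality holds if both sides are defined and equal. -/
def Condition.Holds (G : PropertyGraph) (μ : Assignment) : Condition → Prop
  | .eqConst x a c => μ.prop G x a = some c
  | .eqProp x a y b => ∃ c, μ.prop G x a = some c ∧ μ.prop G y b = some c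
  | .and θ₁ θ₂ => θ₁.Holds G μ ∧ θ₂.Holds G μ
  | .or θ₁ θ₂ => θ₁.Holds G μ ∨ θ₂.Holds G μ
  | .not θ => ¬ θ.Holds G μ

/-- The element `o` has the label, if one is required. -/
def Descriptor.LabelHolds (d : Descriptor) (G : PropertyGraph) (o : Ident) : Prop :=
  ∀ ℓ, d.label = some ℓ → ℓ ∈ G.lab o

/-- Sequences of `k` consecutive matches from `S`, with the list of their assignments. -/
def power (G : PropertyGraph) (S : Set (Path × Assignment)) :
    ℕ → Set (Path × List Assignment)
  | 0 => {r | ∃ u ∈ G.nodes, r = (⟨u, []⟩, [])}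
  | k + 1 => {r | ∃ p μ q l, (p, μ) ∈ S ∧ (q, l) ∈ power G S k ∧ p.tgt = q.src ∧
      r = (p.append q, μ :: l)}

/-- The matches of a pattern: paths together with assignments. -/
def Pattern.eval (G : PropertyGraph) : Pattern → Set (Path × Assignment)
  | .node d => {r | ∃ u ∈ G.nodes, d.LabelHolds G u ∧
      r = (⟨u, []⟩, Assignment.single d.var (.node u))}
  | .edge .forward d => {r | ∃ e ∈ G.edges, d.LabelHolds G e ∧
      r = (⟨G.src e, [(e, G.tgt e)]⟩, Assignment.single d.var (.edge e))}
  | .edge .backward d => {r | ∃ e ∈ G.edges, d.LabelHolds G e ∧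
      r = (⟨G.tgt e, [(e, G.src e)]⟩, Assignment.single d.var (.edge e))}
  | .union π₁ π₂ => {r | ∃ p μ, ((p, μ) ∈ π₁.eval G ∨ (p, μ) ∈ π₂.eval G) ∧
      r = (p, μ.complete (π₁.vars ∪ π₂.vars))}
  | .concat π₁ π₂ => {r | ∃ p₁ μ₁ p₂ μ₂, (p₁, μ₁) ∈ π₁.eval G ∧ (p₂, μ₂) ∈ π₂.eval G ∧
      p₁.tgt = p₂.src ∧ μ₁.Compatible μ₂ ∧ r = (p₁.append p₂, μ₁.union μ₂)}
  | .cond π θ => {r | r ∈ π.eval G ∧ θ.Holds G r.2}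
  | .rep π n m => {r | ∃ k p l, n ≤ k ∧ (∀ b, m = some b → k ≤ b) ∧
      (p, l) ∈ power G (π.eval G) k ∧ r = (p, Assignment.collect π.vars l)}

/-- The matches selected by a restrictor: no repeated node, no repeated edge, or minimal length
among the matches with the same endpoints. -/
def Restrictor.select : Restrictor → Set (Path × Assignment) → Set (Path × Assignment)
  | .simple, S => {r | r ∈ S ∧ r.1.nodes.Nodup}
  | .trail, S => {r | r ∈ S ∧ r.1.edges.Nodup}
  | .shortest, S => {r | r ∈ S ∧ ∀ r' ∈ S, r'.1.src = r.1.src → r'.1.tgt = r.1.tgt →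
      r.1.length ≤ r'.1.length}

/-- The assignments of all variables of a query that result from its matches. -/
def Query.eval (G : PropertyGraph) : Query → Set Assignment
  | .path ρ π => {μ | ∃ p, (p, μ) ∈ ρ.select (π.eval G)}
  | .join Q₁ Q₂ => {μ | ∃ μ₁ ∈ Q₁.eval G, ∃ μ₂ ∈ Q₂.eval G, μ₁.Compatible μ₂ ∧ μ = μ₁.union μ₂}
  | .cond Q θ => {μ | μ ∈ Q.eval G ∧ θ.Holds G μ}

open Classical in
/-- The answers to a query: the bindings of its singleton variables. -/
noncomputable def Query.answers (G : PropertyGraph) (Q : Query) : Set Assignment :=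
  {β | ∃ μ ∈ Q.eval G, β = fun x => if Q.sch.Singleton x then μ x else none}

/-- A query is satisfiable if it has an answer on some property graph. -/
def Query.Satisfiable (Q : Query) : Prop := ∃ G : PropertyGraph, (Q.answers G).Nonempty

/-! #### Queries as words: prefix notation -/

/-- The alphabet in which queries are written. -/
inductive Token
  | bit (b : Bool)
  | terminator
  | absent
  | present
  | node
  | forward
  | backward
  | union
  | concat
  | cond
  | rep
  | eqConst
  | eqProp
  | and
  | or
  | not
  | simple
  | trail
  | shortest
  | join
  deriving DecidableEq, Fintype

/-- A name is written letter by letter and terminated. -/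
def encodeName (s : Name) : List Token := s.map .bit ++ [.terminator]

/-- Numbers are written in binary. -/
def encodeNumber (n : ℕ) : List Token := encodeName (Computability.encodeNat n)

/-- Optional parts of an expression. -/
def encodeOption {α : Type} (enc : α → List Token) : Option α → List Token
  | none => [.absent]
  | some a => .present :: enc a

/-- Descriptors as words. -/
def Descriptor.encode (d : Descriptor) : List Token :=
  encodeOption encodeName d.var ++ encodeOption encodeName d.label

/-- Conditions as words. -/
def Condition.encode : Condition → List Token
  | .eqConst x a c => .eqConst :: (encodeName x ++ (encodeName a ++ encodeName c))
  | .eqProp x a y b =>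
    .eqProp :: (encodeName x ++ (encodeName a ++ (encodeName y ++ encodeName b)))
  | .and θ₁ θ₂ => .and :: (θ₁.encode ++ θ₂.encode)
  | .or θ₁ θ₂ => .or :: (θ₁.encode ++ θ₂.encode)
  | .not θ => .not :: θ.encode

/-- Path patterns as words. -/
def Pattern.encode : Pattern → List Token
  | .node d => .node :: d.encode
  | .edge .forward d => .forward :: d.encode
  | .edge .backward d => .backward :: d.encode
  | .union π₁ π₂ => .union :: (π₁.encode ++ π₂.encode)
  | .concat π₁ π₂ => .concat :: (π₁.encode ++ π₂.encode)
  | .cond π θ => .cond :: (π.encode ++ θ.encode)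
  | .rep π n m => .rep :: (π.encode ++ (encodeNumber n ++ encodeOption encodeNumber m))

/-- Restrictors as letters. -/
def Restrictor.token : Restrictor → Token
  | .simple => .simple
  | .trail => .trail
  | .shortest => .shortest

/-- Queries as words. -/
def Query.encode : Query → List Token
  | .path ρ π => ρ.token :: π.encode
  | .join Q₁ Q₂ => .join :: (Q₁.encode ++ Q₂.encode)
  | .cond Q θ => .cond :: (Q.encode ++ θ.encode)

/-- An unambiguous prefix notation. -/
def PrefixCode {α : Type} (enc : α → List Token) : Prop :=
  ∀ a b s t, enc a ++ s = enc b ++ t → a = b ∧ s = t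

theorem prefixCode_name : PrefixCode encodeName := by
  intro a
  induction a with
  | nil => intro b s t h; cases b <;> simp_all [encodeName]
  | cons x a ih =>
    intro b s t h
    cases b with
    | nil => simp [encodeName] at h
    | cons y b =>
      simp only [encodeName, List.map_cons, List.cons_append, List.cons.injEq,
        Token.bit.injEq] at h
      obtain ⟨h1, h2⟩ := ih b s t h.2
      simp [h.1, h1, h2]

theorem prefixCode_number : PrefixCode encodeNumber := by
  intro a b s t h
  obtain ⟨h1, h2⟩ := prefixCode_name _ _ _ _ h
  refine ⟨?_, h2⟩
  rw [← Computability.decode_encodeNat a, h1, Computability.decode_encodeNat]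

theorem prefixCode_option {α : Type} {enc : α → List Token} (he : PrefixCode enc) :
    PrefixCode (encodeOption enc) := by
  intro a b s t h
  cases a <;> cases b <;> simp [encodeOption] at h ⊢
  · exact h
  · exact he _ _ _ _ h

theorem prefixCode_descriptor : PrefixCode Descriptor.encode := by
  rintro ⟨x, l⟩ ⟨y, m⟩ s t h
  simp only [Descriptor.encode, List.append_assoc] at h
  replace h := prefixCode_option prefixCode_name _ _ _ _ h
  obtain ⟨rfl, h⟩ := h
  replace h := prefixCode_option prefixCode_name _ _ _ _ h
  obtain ⟨rfl, h⟩ := h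
  exact ⟨rfl, h⟩

theorem prefixCode_condition : PrefixCode Condition.encode := by
  intro a
  induction a with
  | eqConst x k c =>
    intro b s t h
    cases b <;> simp only [Condition.encode, List.append_assoc, List.cons_append,
      List.cons.injEq, reduceCtorEq, false_and, true_and] at h
    replace h := prefixCode_name _ _ _ _ h
    obtain ⟨rfl, h⟩ := h
    replace h := prefixCode_name _ _ _ _ h
    obtain ⟨rfl, h⟩ := h
    replace h := prefixCode_name _ _ _ _ h
    obtain ⟨rfl, h⟩ := h
    exact ⟨rfl, h⟩
  | eqProp x k y l =>
    intro b s t h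
    cases b <;> simp only [Condition.encode, List.append_assoc, List.cons_append,
      List.cons.injEq, reduceCtorEq, false_and, true_and] at h
    replace h := prefixCode_name _ _ _ _ h
    obtain ⟨rfl, h⟩ := h
    replace h := prefixCode_name _ _ _ _ h
    obtain ⟨rfl, h⟩ := h
    replace h := prefixCode_name _ _ _ _ h
    obtain ⟨rfl, h⟩ := h
    replace h := prefixCode_name _ _ _ _ h
    obtain ⟨rfl, h⟩ := h
    exact ⟨rfl, h⟩
  | and c d ihc ihd =>
    intro b s t h
    cases b <;> simp only [Condition.encode, List.append_assoc, List.cons_append,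
      List.cons.injEq, reduceCtorEq, false_and, true_and] at h
    replace h := ihc _ _ _ h
    obtain ⟨rfl, h⟩ := h
    replace h := ihd _ _ _ h
    obtain ⟨rfl, h⟩ := h
    exact ⟨rfl, h⟩
  | or c d ihc ihd =>
    intro b s t h
    cases b <;> simp only [Condition.encode, List.append_assoc, List.cons_append,
      List.cons.injEq, reduceCtorEq, false_and, true_and] at h
    replace h := ihc _ _ _ h
    obtain ⟨rfl, h⟩ := h
    replace h := ihd _ _ _ h
    obtain ⟨rfl, h⟩ := h
    exact ⟨rfl, h⟩
  | not c ihc =>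
    intro b s t h
    cases b <;> simp only [Condition.encode, List.cons_append,
      List.cons.injEq, reduceCtorEq, false_and, true_and] at h
    replace h := ihc _ _ _ h
    obtain ⟨rfl, h⟩ := h
    exact ⟨rfl, h⟩

theorem prefixCode_pattern : PrefixCode Pattern.encode := by
  intro a
  induction a with
  | node d =>
    intro b s t h
    rcases b with _ | ⟨_ | _, _⟩ | _ | _ | _ | _ <;> simp only [Pattern.encode,
      List.append_assoc, List.cons_append, List.cons.injEq, reduceCtorEq, false_and, true_and] at h
    replace h := prefixCode_descriptor _ _ _ _ h
    obtain ⟨rfl, h⟩ := h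
    exact ⟨rfl, h⟩
  | edge dir d =>
    intro b s t h
    rcases dir with _ | _ <;> rcases b with _ | ⟨_ | _, _⟩ | _ | _ | _ | _ <;>
      simp only [Pattern.encode,
      List.append_assoc, List.cons_append, List.cons.injEq, reduceCtorEq, false_and, true_and] at h
    all_goals
      replace h := prefixCode_descriptor _ _ _ _ h
      obtain ⟨rfl, h⟩ := h
      exact ⟨rfl, h⟩
  | union c d ihc ihd =>
    intro b s t h
    rcases b with _ | ⟨_ | _, _⟩ | _ | _ | _ | _ <;> simp only [Pattern.encode,
      List.append_assoc, List.cons_append, List.cons.injEq, reduceCtorEq, false_and, true_and] at h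
    replace h := ihc _ _ _ h
    obtain ⟨rfl, h⟩ := h
    replace h := ihd _ _ _ h
    obtain ⟨rfl, h⟩ := h
    exact ⟨rfl, h⟩
  | concat c d ihc ihd =>
    intro b s t h
    rcases b with _ | ⟨_ | _, _⟩ | _ | _ | _ | _ <;> simp only [Pattern.encode,
      List.append_assoc, List.cons_append, List.cons.injEq, reduceCtorEq, false_and, true_and] at h
    replace h := ihc _ _ _ h
    obtain ⟨rfl, h⟩ := h
    replace h := ihd _ _ _ h
    obtain ⟨rfl, h⟩ := h
    exact ⟨rfl, h⟩
  | cond c θ ihc =>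
    intro b s t h
    rcases b with _ | ⟨_ | _, _⟩ | _ | _ | _ | _ <;> simp only [Pattern.encode,
      List.append_assoc, List.cons_append, List.cons.injEq, reduceCtorEq, false_and, true_and] at h
    replace h := ihc _ _ _ h
    obtain ⟨rfl, h⟩ := h
    replace h := prefixCode_condition _ _ _ _ h
    obtain ⟨rfl, h⟩ := h
    exact ⟨rfl, h⟩
  | rep c n m ihc =>
    intro b s t h
    rcases b with _ | ⟨_ | _, _⟩ | _ | _ | _ | _ <;> simp only [Pattern.encode,
      List.append_assoc, List.cons_append, List.cons.injEq, reduceCtorEq, false_and, true_and] at h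
    replace h := ihc _ _ _ h
    obtain ⟨rfl, h⟩ := h
    replace h := prefixCode_number _ _ _ _ h
    obtain ⟨rfl, h⟩ := h
    replace h := prefixCode_option prefixCode_number _ _ _ _ h
    obtain ⟨rfl, h⟩ := h
    exact ⟨rfl, h⟩

theorem prefixCode_query : PrefixCode Query.encode := by
  intro a
  induction a with
  | path ρ π =>
    intro b s t h
    rcases b with ⟨ρ', π'⟩ | _ | _ <;> rcases ρ with _ | _ | _ <;>
      (try rcases ρ' with _ | _ | _) <;> simp only [Query.encode, Restrictor.token,
      List.append_assoc, List.cons_append, List.cons.injEq, reduceCtorEq, false_and, true_and] at h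
    all_goals
      replace h := prefixCode_pattern _ _ _ _ h
      obtain ⟨rfl, h⟩ := h
      exact ⟨rfl, h⟩
  | join c d ihc ihd =>
    intro b s t h
    rcases b with ⟨_ | _ | _, _⟩ | _ | _ <;> simp only [Query.encode, Restrictor.token,
      List.append_assoc, List.cons_append, List.cons.injEq, reduceCtorEq, false_and, true_and] at h
    replace h := ihc _ _ _ h
    obtain ⟨rfl, h⟩ := h
    replace h := ihd _ _ _ h
    obtain ⟨rfl, h⟩ := h
    exact ⟨rfl, h⟩
  | cond c θ ihc =>
    intro b s t h
    rcases b with ⟨_ | _ | _, _⟩ | _ | _ <;> simp only [Query.encode, Restrictor.token,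
      List.append_assoc, List.cons_append, List.cons.injEq, reduceCtorEq, false_and, true_and] at h
    replace h := ihc _ _ _ h
    obtain ⟨rfl, h⟩ := h
    replace h := prefixCode_condition _ _ _ _ h
    obtain ⟨rfl, h⟩ := h
    exact ⟨rfl, h⟩

theorem Query.encode_injective : Function.Injective Query.encode := by
  intro a b h
  exact (prefixCode_query a b [] [] (by rw [h])).1

/-! #### The satisfiability problem -/

/-- The well-typed queries in a class `C` of queries. -/
abbrev Instances (C : Set Query) : Type := {Q : Query // Q.WellTyped ∧ Q ∈ C}

/-- Prefix notation for the queries in a class. -/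
noncomputable def instanceEncoding (C : Set Query) :
    Computability.Encoding (Instances C) Token where
  encode Q := Q.1.encode
  decode := Function.partialInv fun Q : Instances C => Q.1.encode
  decode_encode Q :=
    Function.partialInv_left (Query.encode_injective.comp Subtype.val_injective) Q

/-- Given a well-typed query in the class `C`, is it satisfiable? -/
noncomputable def satisfiability (C : Set Query) : Complexity.DecisionProblem where
  Instance := Instances C
  Alphabet := Token
  encoding := instanceEncoding C
  yes := {Q | Q.1.Satisfiable}

end GPC

/-! A space-bounded computation is encoded as a path whose nodes are configurations. Let `M` decide
`L` within `(n + 2) ^ k` cells. The query for `w` asks for a path of arbitrary length whose nodes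
carry, as properties, a state name, a head position and one symbol per cell under a unary key. Each
edge is matched by a repeated pattern that binds its two end nodes to singleton variables and
requires the target to be the successor of the source. Since only consecutive nodes are compared,
one condition of polynomial size controls computations of exponential length. The path begins at a
node with an artificial initial state, whose outgoing step puts `w` on the tape. It ends at a node
with an artificial accepting state, which can first be entered only after a halting accepting
configuration.

If some graph has a match, the invariant `Reached` propagates along it (`Reached.step`,
`Reached.power`), so `M` accepts (`accepts_of_mem_eval`). Conversely, an accepting run is laid out
as a `chain`, whose edges satisfy the step condition (`Successive.holds`). Its path repeats no node
and no edge, and every nonempty set of matches contains a shortest one, so the same pattern serves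
all three restrictors (`satisfiable_iff_accepts`).

The reduction must also run in polynomial time on a `TM2` stack machine. In prefix notation the
query is a fixed beginning, one instance of a single template for each cell index and input letter,
and a fixed end (`encode_computation`, `isTemplate_cellConditions`). Such texts are written by a
small structured program over stacks. Compilation turns its number of loop tests into a bound on
machine steps (`Exec.run_compiled`, `generated_polyTime`). -/

namespace StackProgram

/-! ### Structured stack programs and their compilation to `TM2` machines. -/

open Turing Function

variable {K : Type} [DecidableEq K] {Γ : K → Type} {α : Type}

/-- Structured programs over the stacks `K`, with a register of type `α`. -/
inductive Prog (Γ : K → Type) (α : Type) : Type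
  | skip
  | push (k : K) (f : α → Γ k)
  | pop (k : K) (f : α → Option (Γ k) → α)
  | load (f : α → α)
  | seq (P Q : Prog Γ α)
  | loop (k : K) (P : Prog Γ α)

/-- The value of the register and the contents of the stacks. -/
abbrev Store (Γ : K → Type) (α : Type) : Type := α × ((k : K) → List (Γ k))

/-- `Exec P s s' n`: started in `s`, the program `P` ends in `s'` after at most `n` loop tests. The
program `loop k P` repeats `P` until the stack `k` is empty. -/
inductive Exec : Prog Γ α → Store Γ α → Store Γ α → ℕ → Prop
  | skip (s) : Exec .skip s s 0
  | push (k f) (s : Store Γ α) :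
      Exec (.push k f) s (s.1, update s.2 k (f s.1 :: s.2 k)) 0
  | pop (k f) (s : Store Γ α) :
      Exec (.pop k f) s (f s.1 (s.2 k).head?, update s.2 k (s.2 k).tail) 0
  | load (f) (s : Store Γ α) : Exec (.load f) s (f s.1, s.2) 0
  | seq {P Q s₁ s₂ s₃ m n} : Exec P s₁ s₂ m → Exec Q s₂ s₃ n → Exec (.seq P Q) s₁ s₃ (m + n)
  | done {k P} {s : Store Γ α} : s.2 k = [] → Exec (.loop k P) s s 1
  | loop {k P} {s₁ s₂ s₃ : Store Γ α} {m n} : s₁.2 k ≠ [] → Exec P s₁ s₂ m →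
      Exec (.loop k P) s₂ s₃ n → Exec (.loop k P) s₁ s₃ (m + n + 1)
  | mono {P s s' m n} : Exec P s s' m → m ≤ n → Exec P s s' n

namespace Prog

/-- The labels of the compiled program: one for each loop. -/
def Label : Prog Γ α → Type
  | skip => Empty
  | push _ _ => Empty
  | pop _ _ => Empty
  | load _ => Empty
  | seq P Q => P.Label ⊕ Q.Label
  | loop _ P => Option P.Label

instance fintypeLabel : (P : Prog Γ α) → Fintype P.Label
  | skip => inferInstanceAs (Fintype Empty)
  | push _ _ => inferInstanceAs (Fintype Empty)
  | pop _ _ => inferInstanceAs (Fintype Empty)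
  | load _ => inferInstanceAs (Fintype Empty)
  | seq P Q =>
    letI := fintypeLabel P
    letI := fintypeLabel Q
    inferInstanceAs (Fintype (P.Label ⊕ Q.Label))
  | loop _ P =>
    letI := fintypeLabel P
    inferInstanceAs (Fintype (Option P.Label))

variable {Λ : Type}

/-- The statement that starts the program `P` and continues with `exit`; the labels of `P` are
placed by `e`. The Boolean part of the internal state is used in loop tests. -/
def entry : (P : Prog Γ α) → (P.Label → Λ) → TM2.Stmt Γ Λ (α × Bool) → TM2.Stmt Γ Λ (α × Bool)
  | skip, _, exit => exit
  | push k f, _, exit => .push k (fun v => f v.1) exit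
  | pop k f, _, exit => .pop k (fun v o => (f v.1 o, v.2)) exit
  | load f, _, exit => .load (fun v => (f v.1, v.2)) exit
  | seq P Q, e, exit => P.entry (e ∘ Sum.inl) (Q.entry (e ∘ Sum.inr) exit)
  | loop _ _, e, _ => .goto fun _ => e none

/-- The statements at the labels of the compiled program. -/
def code : (P : Prog Γ α) → (P.Label → Λ) → TM2.Stmt Γ Λ (α × Bool) →
    P.Label → TM2.Stmt Γ Λ (α × Bool)
  | skip, _, _ => Empty.elim
  | push _ _, _, _ => Empty.elim
  | pop _ _, _, _ => Empty.elim
  | load _, _, _ => Empty.elim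
  | seq P Q, e, exit => Sum.elim (P.code (e ∘ Sum.inl) (Q.entry (e ∘ Sum.inr) exit))
      (Q.code (e ∘ Sum.inr) exit)
  | loop k P, e, exit => fun l => Option.elim l
      (.peek k (fun v o => (v.1, o.isSome)) <| .branch Prod.snd
        (P.entry (e ∘ some) (.goto fun _ => e none)) exit)
      (P.code (e ∘ some) (.goto fun _ => e none))

end Prog

/-- `n` steps of a machine. -/
def run {Λ σ : Type} (M : Λ → TM2.Stmt Γ Λ σ) (n : ℕ) :
    Option (TM2.Cfg Γ Λ σ) → Option (TM2.Cfg Γ Λ σ) := (flip bind (TM2.step M))^[n]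

theorem run_add {Λ σ : Type} (M : Λ → TM2.Stmt Γ Λ σ) (m n : ℕ) (c : Option (TM2.Cfg Γ Λ σ)) :
    run M (m + n) c = run M n (run M m c) := by
  rw [Nat.add_comm, run, iterate_add_apply]; rfl

/-- Compiled programs simulate executions, with one machine step for each loop test. -/
theorem Exec.run_compiled {Λ : Type} {M : Λ → TM2.Stmt Γ Λ (α × Bool)} {P : Prog Γ α}
    {s s' : Store Γ α} {n : ℕ} (h : Exec P s s' n) :
    ∀ (e : P.Label → Λ) (exit : TM2.Stmt Γ Λ (α × Bool)), (∀ l, M (e l) = P.code e exit l) →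
      ∀ b, ∃ b', ∃ m ≤ n, run M m (some (TM2.stepAux (P.entry e exit) (s.1, b) s.2)) =
        some (TM2.stepAux exit (s'.1, b') s'.2) := by
  -- The placement `e` and the continuation `exit` stay quantified, because subprograms are compiled
  -- with other continuations, such as the jump back to a loop test. Straight-line code costs no
  -- step of its own: a `TM2` statement runs up to its next jump within one step.
  induction h with
  | skip s => exact fun e exit _ b => ⟨b, 0, le_rfl, rfl⟩
  | push k f s => exact fun e exit _ b => ⟨b, 0, le_rfl, rfl⟩
  | pop k f s => exact fun e exit _ b => ⟨b, 0, le_rfl, rfl⟩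
  | load f s => exact fun e exit _ b => ⟨b, 0, le_rfl, rfl⟩
  | @seq P Q _ _ _ _ _ _ _ ih₁ ih₂ =>
    intro e exit hM b
    obtain ⟨b₁, m₁, hm₁, h₁⟩ := ih₁ (e ∘ Sum.inl) (Q.entry (e ∘ Sum.inr) exit)
      (fun l => hM (Sum.inl l)) b
    obtain ⟨b₂, m₂, hm₂, h₂⟩ := ih₂ (e ∘ Sum.inr) exit (fun l => hM (Sum.inr l)) b₁
    exact ⟨b₂, m₁ + m₂, by lia, by rw [run_add, Prog.entry, h₁, h₂]⟩
  | @done k P s hs =>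
    intro e exit hM b
    refine ⟨false, 1, le_rfl, ?_⟩
    have := hM none
    simp [run, flip, Prog.entry, TM2.step, this, Prog.code, hs]
  | @loop k P s₁ s₂ s₃ m n hs _ _ ih₁ ih₂ =>
    intro e exit hM b
    obtain ⟨b₁, m₁, hm₁, h₁⟩ := ih₁ (e ∘ some) (.goto fun _ => e none) (fun l => hM (some l)) true
    obtain ⟨b₂, m₂, hm₂, h₂⟩ := ih₂ e exit hM b₁
    -- One step for the test, `m₁` for the body, `m₂` for the remaining rounds. The continuation of
    -- the body is the very jump that enters the loop, so the second run starts where the first one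
    -- ends.
    refine ⟨b₂, 1 + (m₁ + m₂), by lia, ?_⟩
    rw [run_add, run_add]
    have h₀ : run M 1 (some (TM2.stepAux ((Prog.loop k P).entry e exit) (s₁.1, b) s₁.2)) =
        some (TM2.stepAux (P.entry (e ∘ some) (.goto fun _ => e none)) (s₁.1, true) s₁.2) := by
      have := hM none
      have hs' : (s₁.2 k).head?.isSome = true := by
        cases h : s₁.2 k <;> simp_all
      simp [run, flip, Prog.entry, TM2.step, this, Prog.code, hs']
    rw [h₀, h₁]
    exact h₂
  | mono _ hmn ih =>
    intro e exit hM b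
    obtain ⟨b', m, hm, h⟩ := ih e exit hM b
    exact ⟨b', m, hm.trans hmn, h⟩

/-- The machine that runs the program `P` from the register value `a` on. -/
def machine [Fintype K] [Fintype α] (k₀ k₁ : K) [Fintype (Γ k₀)] (a : α) (P : Prog Γ α) :
    FinTM2 where
  K := K
  k₀ := k₀
  k₁ := k₁
  Γ := Γ
  Λ := Option P.Label
  main := none
  σ := α × Bool
  initialState := (a, false)
  -- The final `load` restores the initial internal state, which `haltList` demands.
  m := fun l => Option.elim l (P.entry some (.load (fun _ => (a, false)) .halt))
    (P.code some (.load (fun _ => (a, false)) .halt))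

/-- A loop that empties its stack in `n` rounds along a known sequence of stores. -/
theorem Exec.loop_of_forall {k : K} {P : Prog Γ α} {n c : ℕ} (f : ℕ → Store Γ α)
    (hne : ∀ i < n, (f i).2 k ≠ []) (hnil : (f n).2 k = [])
    (hP : ∀ i < n, Exec P (f i) (f (i + 1)) c) : Exec (.loop k P) (f 0) (f n) (n * (c + 1) + 1) := by
  induction n generalizing f with
  | zero => exact (Exec.done hnil).mono (by lia)
  | succ n ih =>
    have h := ih (fun i => f (i + 1)) (fun i hi => hne _ (by lia)) hnil fun i hi => hP _ (by lia)
    exact ((Exec.loop (hne 0 (by lia)) (hP 0 (by lia)) h)).mono (le_of_eq (by ring))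

/-- Translates the stacks of `initList` and `haltList`, which are given by a case distinction with a
cast, into `Function.update`. -/
theorem dite_eq_update (k₀ : K) (v : List (Γ k₀)) :
    (fun k => if h : k = k₀ then (by rw [h]; exact v) else ([] : List (Γ k))) =
      update (fun _ => []) k₀ v := by
  funext k
  by_cases hk : k = k₀
  · subst hk; simp
  · simp [hk]

/-- A program computes what its executions do. -/
theorem machine_outputs [Fintype K] [Fintype α] (k₀ k₁ : K) [Fintype (Γ k₀)] (a : α)
    (P : Prog Γ α) (v : List (Γ k₀)) (u : List (Γ k₁)) (a' : α) (n : ℕ)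
    (h : Exec P (a, update (fun _ => []) k₀ v) (a', update (fun _ => []) k₁ u) n) :
    Nonempty (TM2OutputsInTime (machine k₀ k₁ a P) v (some u) (n + 1)) := by
  obtain ⟨b, m, hm, hr⟩ := h.run_compiled (M := (machine k₀ k₁ a P).m) some
    (.load (fun _ => (a, false)) .halt) (fun _ => rfl) false
  have e₀ : initList (machine k₀ k₁ a P) v =
      (⟨some none, (a, false), update (fun _ => []) k₀ v⟩ : TM2.Cfg Γ _ _) :=
    congrArg (TM2.Cfg.mk (Γ := Γ) (some (none : Option P.Label)) (a, false)) (dite_eq_update k₀ v)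
  have e₁ : haltList (machine k₀ k₁ a P) u =
      (⟨none, (a, false), update (fun _ => []) k₁ u⟩ : TM2.Cfg Γ (Option P.Label) _) :=
    congrArg (TM2.Cfg.mk (Γ := Γ) (none : Option (Option P.Label)) (a, false)) (dite_eq_update k₁ u)
  -- One step more than in `hr`: it leaves the start label `none` by executing the entry of `P`.
  have key : (flip bind (machine k₀ k₁ a P).step)^[m + 1]
      (some (initList (machine k₀ k₁ a P) v)) = some (haltList (machine k₀ k₁ a P) u) := by
    refine Eq.trans ?_ (hr.trans (congrArg some e₁.symm))
    exact congrArg (fun c => (flip bind (machine k₀ k₁ a P).step)^[m + 1] (some c)) e₀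
  exact ⟨⟨⟨m + 1, key⟩, by lia⟩⟩

end StackProgram

/-! ### Counter arithmetic and a polynomial-time generator of texts. -/

namespace StackProgram

open Turing Function

/-- A stack for the input, one for the output, two for copies of the input, and four counters. -/
inductive Stack
  | inp
  | out
  | rev
  | word
  | x
  | t
  | y
  | z
  deriving DecidableEq

instance : Fintype Stack where
  elems := {.inp, .out, .rev, .word, .x, .t, .y, .z}
  complete k := by cases k <;> decide

/-- The alphabets of the stacks, all finite if `A` and `B` are. -/
def Stack.Alphabet (A B : Type) : Stack → Type
  | inp => A
  | out => B
  | rev => Option A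
  | word => Option A
  | _ => Unit

variable {A B : Type}

/-- Programs with the above stacks and a register for an optional letter of the input. -/
abbrev Program (A B : Type) : Type := Prog (Stack.Alphabet A B) (Option A)

/-- The store with the given contents. -/
def store (a : Option A) (i : List A) (o : List B) (r w : List (Option A)) (x t y z : ℕ) :
    Store (Stack.Alphabet A B) (Option A) :=
  (a, fun
    | .inp => i
    | .out => o
    | .rev => r
    | .word => w
    | .x => List.replicate x ()
    | .t => List.replicate t ()
    | .y => List.replicate y ()
    | .z => List.replicate z ())

/-- Allows the resulting store to be checked stack by stack, so that for explicit stores every case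
is `rfl`. -/
theorem exec_push {k : Stack} {f : Option A → Stack.Alphabet A B k}
    {s s' : Store (Stack.Alphabet A B) (Option A)} (h₁ : s.1 = s'.1)
    (h₂ : ∀ j, update s.2 k (f s.1 :: s.2 k) j = s'.2 j) : Exec (.push k f) s s' 0 := by
  have : s' = (s.1, update s.2 k (f s.1 :: s.2 k)) := Prod.ext h₁.symm (funext fun j => (h₂ j).symm)
  exact this ▸ Exec.push k f s

theorem exec_pop {k : Stack} {f : Option A → Option (Stack.Alphabet A B k) → Option A}
    {s s' : Store (Stack.Alphabet A B) (Option A)} (h₁ : f s.1 (s.2 k).head? = s'.1)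
    (h₂ : ∀ j, update s.2 k (s.2 k).tail j = s'.2 j) : Exec (.pop k f) s s' 0 := by
  have : s' = (f s.1 (s.2 k).head?, update s.2 k (s.2 k).tail) :=
    Prod.ext h₁.symm (funext fun j => (h₂ j).symm)
  exact this ▸ Exec.pop k f s

variable {a : Option A} {i : List A} {o : List B} {r w : List (Option A)} {x t y z : ℕ}

section Steps

theorem exec_push_x : Exec (.push .x fun _ => ()) (store a i o r w x t y z)
    (store a i o r w (x + 1) t y z) 0 := exec_push rfl fun j => by cases j <;> rfl

theorem exec_push_t : Exec (.push .t fun _ => ()) (store a i o r w x t y z)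
    (store a i o r w x (t + 1) y z) 0 := exec_push rfl fun j => by cases j <;> rfl

theorem exec_push_y : Exec (.push .y fun _ => ()) (store a i o r w x t y z)
    (store a i o r w x t (y + 1) z) 0 := exec_push rfl fun j => by cases j <;> rfl

theorem exec_push_z : Exec (.push .z fun _ => ()) (store a i o r w x t y z)
    (store a i o r w x t y (z + 1)) 0 := exec_push rfl fun j => by cases j <;> rfl

theorem exec_push_out {f : Option A → B} : Exec (.push .out f) (store a i o r w x t y z)
    (store a i (f a :: o) r w x t y z) 0 := exec_push rfl fun j => by cases j <;> rfl

theorem exec_push_rev : Exec (.push .rev id : Program A B) (store a i o r w x t y z)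
    (store a i o (a :: r) w x t y z) 0 := exec_push rfl fun j => by cases j <;> rfl

theorem exec_push_word : Exec (.push .word id : Program A B) (store a i o r w x t y z)
    (store a i o r (a :: w) x t y z) 0 := exec_push rfl fun j => by cases j <;> rfl

theorem exec_pop_x : Exec (.pop .x fun a _ => a) (store a i o r w x t y z)
    (store a i o r w (x - 1) t y z) 0 := exec_pop rfl fun j => by cases j <;> cases x <;> rfl

theorem exec_pop_t : Exec (.pop .t fun a _ => a) (store a i o r w x t y z)
    (store a i o r w x (t - 1) y z) 0 := exec_pop rfl fun j => by cases j <;> cases t <;> rfl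

theorem exec_pop_y : Exec (.pop .y fun a _ => a) (store a i o r w x t y z)
    (store a i o r w x t (y - 1) z) 0 := exec_pop rfl fun j => by cases j <;> cases y <;> rfl

theorem exec_pop_z : Exec (.pop .z fun a _ => a) (store a i o r w x t y z)
    (store a i o r w x t y (z - 1)) 0 := exec_pop rfl fun j => by cases j <;> cases z <;> rfl

theorem exec_pop_inp : Exec (.pop .inp fun _ b => b : Program A B) (store a i o r w x t y z)
    (store i.head? i.tail o r w x t y z) 0 := exec_pop rfl fun j => by cases j <;> rfl

theorem exec_pop_rev : Exec (.pop .rev fun _ b => b.join) (store a i o r w x t y z)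
    (store r.head?.join i o r.tail w x t y z) 0 := exec_pop rfl fun j => by cases j <;> rfl

theorem exec_pop_word : Exec (.pop .word fun _ b => b.join) (store a i o r w x t y z)
    (store w.head?.join i o r w.tail x t y z) 0 := exec_pop rfl fun j => by cases j <;> rfl

theorem exec_clear : Exec (.load fun _ => none) (store a i o r w x t y z)
    (store none i o r w x t y z) 0 := Exec.load _ _

end Steps

theorem replicate_ne_nil {n i : ℕ} (h : i < n) : List.replicate (n - i) () ≠ [] := by
  simp; lia

theorem drop_ne_nil {T : Type} {l : List T} {i : ℕ} (h : i < l.length) : l.drop i ≠ [] := by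
  simpa using h

/-- Move the counter `t` to `x`. -/
def moveTX : Program A B := .loop .t (.seq (.pop .t fun a _ => a) (.push .x fun _ => ()))

theorem exec_moveTX : Exec moveTX (store a i o r w x t y z)
    (store a i o r w (x + t) 0 y z) (t + 1) := by
  have h := Exec.loop_of_forall (k := Stack.t) (P := .seq (.pop .t fun a _ => a) (.push .x fun _ => ()))
    (n := t) (c := 0) (fun j => store a i o r w (x + j) (t - j) y z)
    (fun j hj => replicate_ne_nil hj) (by simp [store]) fun j _ => Exec.seq exec_pop_t exec_push_x
  unfold moveTX
  simpa using h

/-- Move the counter `t` to `z`. -/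
def moveTZ : Program A B := .loop .t (.seq (.pop .t fun a _ => a) (.push .z fun _ => ()))

theorem exec_moveTZ : Exec moveTZ (store a i o r w x t y z)
    (store a i o r w x 0 y (z + t)) (t + 1) := by
  have h := Exec.loop_of_forall (k := Stack.t) (P := .seq (.pop .t fun a _ => a) (.push .z fun _ => ()))
    (n := t) (c := 0) (fun j => store a i o r w x (t - j) y (z + j))
    (fun j hj => replicate_ne_nil hj) (by simp [store]) fun j _ => Exec.seq exec_pop_t exec_push_z
  unfold moveTZ
  simpa using h

/-- Move the counter `z` to `y`. -/
def moveZY : Program A B := .loop .z (.seq (.pop .z fun a _ => a) (.push .y fun _ => ()))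

theorem exec_moveZY : Exec moveZY (store a i o r w x t y z)
    (store a i o r w x t (y + z) 0) (z + 1) := by
  have h := Exec.loop_of_forall (k := Stack.z) (P := .seq (.pop .z fun a _ => a) (.push .y fun _ => ()))
    (n := z) (c := 0) (fun j => store a i o r w x t (y + j) (z - j))
    (fun j hj => replicate_ne_nil hj) (by simp [store]) fun j _ => Exec.seq exec_pop_z exec_push_y
  unfold moveZY
  simpa using h

/-- Move the counter `x` to `t` and add it to `z`. -/
def addXZ : Program A B :=
  .loop .x (.seq (.pop .x fun a _ => a) (.seq (.push .t fun _ => ()) (.push .z fun _ => ())))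

theorem exec_addXZ : Exec addXZ (store a i o r w x t y z)
    (store a i o r w 0 (t + x) y (z + x)) (x + 1) := by
  have h := Exec.loop_of_forall (k := Stack.x)
    (P := .seq (.pop .x fun a _ => a) (.seq (.push .t fun _ => ()) (.push .z fun _ => ())))
    (n := x) (c := 0) (fun j => store a i o r w (x - j) (t + j) y (z + j))
    (fun j hj => replicate_ne_nil hj) (by simp [store])
    fun j _ => Exec.seq exec_pop_x (Exec.seq exec_push_t exec_push_z)
  unfold addXZ
  simpa using h

/-- Multiply the counter `y` by `x`. -/
def mulXY : Program A B :=
  .seq (.loop .y (.seq (.pop .y fun a _ => a) (.seq addXZ moveTX))) moveZY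

/-- Each of the `y` rounds adds `x` to `z` and restores `x` from its copy in `t`; finally the
product moves from `z` to `y`. -/
theorem exec_mulXY : Exec mulXY (store a i o r w x 0 y 0)
    (store a i o r w x 0 (y * x) 0) (y * (3 * x + 3) + 2) := by
  have h := Exec.loop_of_forall (k := Stack.y) (P := .seq (.pop .y fun a _ => a) (.seq addXZ moveTX))
    (n := y) (c := 2 * x + 2) (fun j => store a i o r w x 0 (y - j) (j * x))
    (fun j hj => replicate_ne_nil hj) (by simp [store]) fun j _ => by
      have h₁ := exec_addXZ (a := a) (i := i) (o := o) (r := r) (w := w) (x := x) (t := 0)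
        (y := y - (j + 1)) (z := j * x)
      have h₂ := exec_moveTX (a := a) (i := i) (o := o) (r := r) (w := w) (x := 0) (t := x)
        (y := y - (j + 1)) (z := j * x + x)
      rw [Nat.zero_add] at h₁ h₂
      have := Exec.seq (exec_pop_y (a := a) (i := i) (o := o) (r := r) (w := w) (x := x) (t := 0)
        (y := y - j) (z := j * x)) (Exec.seq h₁ h₂)
      rw [← Nat.succ_mul] at this
      exact this.mono (by lia)
  have h' := Exec.seq h (exec_moveZY (a := a) (i := i) (o := o) (r := r) (w := w) (x := x) (t := 0)
        (y := y - y) (z := y * x))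
  simp only [Nat.sub_self, Nat.zero_add, Nat.sub_zero, Nat.zero_mul] at h'
  exact h'.mono (le_of_eq (by ring))

/-- Multiply the counter `y` by `x ^ k`. -/
def powXY : ℕ → Program A B
  | 0 => .skip
  | k + 1 => .seq (powXY k) mulXY

/-- Positivity of `x` makes its powers monotone, so the last multiplication bounds the cost of each
of the `k` multiplications. -/
theorem exec_powXY (hx : 0 < x) (k : ℕ) : Exec (powXY k) (store a i o r w x 0 1 0)
    (store a i o r w x 0 (x ^ k) 0) (k * (x ^ k * (3 * x + 3) + 2)) := by
  induction k with
  | zero => exact (Exec.skip _).mono (by lia)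
  | succ k ih =>
    refine (Exec.seq ih exec_mulXY).mono ?_
    have : x ^ k ≤ x ^ (k + 1) := Nat.pow_le_pow_right hx (by lia)
    calc _ = (k + 1) * (x ^ k * (3 * x + 3) + 2) := by ring
      _ ≤ _ := by gcongr

/-- Copy the input to `word` and count its letters in `x`. -/
def readInput : Program A B :=
  .seq (.loop .inp (.seq (.pop .inp fun _ b => b) (.seq (.push .rev id)
    (.seq (.push .x fun _ => ()) (.load fun _ => none)))))
  (.loop .rev (.seq (.pop .rev fun _ b => b.join) (.seq (.push .word id) (.load fun _ => none))))

/-- Moving a stack reverses it, so the detour through `rev` restores the order of the input. The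
register is cleared in every round to keep the loop invariant uniform. -/
theorem exec_readInput (i : List A) : Exec readInput (store none i o [] [] 0 t y z)
    (store none [] o [] (i.map some) i.length t y z) (2 * i.length + 2) := by
  have h₁ := Exec.loop_of_forall (k := Stack.inp) (P := (.seq (.pop .inp fun _ b => b)
      (.seq (.push .rev id) (.seq (.push .x fun _ => ()) (.load fun _ => none))) : Program A B))
    (n := i.length) (c := 0)
    (fun j => store none (i.drop j) o ((i.map some).take j).reverse [] j t y z)
    (fun j hj => drop_ne_nil (by simpa using hj)) (List.drop_eq_nil_of_le (by simp)) fun j hj => by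
      have := Exec.seq (exec_pop_inp (a := none) (i := i.drop j) (o := o)
        (r := ((i.map some).take j).reverse) (w := []) (x := j) (t := t) (y := y) (z := z))
        (Exec.seq exec_push_rev (Exec.seq exec_push_x exec_clear))
      rw [List.tail_drop] at this
      convert this using 2
      rw [List.take_add_one, List.head?_drop, List.getElem?_map, List.getElem?_eq_getElem hj]
      simp
  have h₂ := Exec.loop_of_forall (k := Stack.rev) (P := (.seq (.pop .rev fun _ b => b.join)
      (.seq (.push .word id) (.load fun _ => none)) : Program A B))
    (n := i.length) (c := 0) (fun j => store none [] o ((i.map some).reverse.drop j)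
      (((i.map some).reverse.take j).reverse) i.length t y z)
    (fun j hj => drop_ne_nil (by simpa using hj)) (List.drop_eq_nil_of_le (by simp)) fun j hj => by
      have := Exec.seq (exec_pop_rev (a := none) (i := []) (o := o)
        (r := (i.map some).reverse.drop j) (w := ((i.map some).reverse.take j).reverse)
        (x := i.length) (t := t) (y := y) (z := z))
        (Exec.seq exec_push_word exec_clear)
      convert this using 2
      · simp
      · have hj' : j < (i.map some).reverse.length := by simpa using hj
        have hs : ((i.map some).reverse)[j]? = some (i[i.length - 1 - j]?) := by
          rw [List.getElem?_eq_getElem hj']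
          simp
        rw [List.take_add_one, List.head?_drop, hs]
        simp
  have e : (i.map some).take i.length = i.map some := List.take_of_length_le (by simp)
  have e' : (i.map some).reverse.take i.length = (i.map some).reverse :=
    List.take_of_length_le (by simp)
  have e'' : (i.map some).reverse.drop i.length = [] := List.drop_eq_nil_of_le (by simp)
  simp only [e, e', e'', List.drop_zero, List.take_zero, List.drop_length, List.reverse_nil,
    List.reverse_reverse] at h₁ h₂
  exact (Exec.seq h₁ h₂).mono (by lia)

/-- The building blocks of templates: letters, which may depend on the letter in the register, and
the unary representation of the counter `z`. -/
inductive Piece (A B : Type)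
  | letter (f : Option A → B)
  | index

/-- The text of a building block. -/
def Piece.text (one : B) (n : ℕ) (a : Option A) : Piece A B → List B
  | letter f => [f a]
  | index => List.replicate n one

/-- Write the text of a building block. -/
def Piece.emit (one : B) : Piece A B → Program A B
  | letter f => .push .out f
  | index => .seq (.loop .z (.seq (.pop .z fun a _ => a)
      (.seq (.push .t fun _ => ()) (.push .out fun _ => one)))) moveTZ

/-- Writing the index consumes `z`; the copy in `t` is moved back afterwards. -/
theorem Piece.exec_emit (one : B) (p : Piece A B) : Exec (p.emit one) (store a i o r w x 0 y z)
    (store a i (p.text one z a ++ o) r w x 0 y z) (2 * z + 2) := by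
  cases p with
  | letter f => exact exec_push_out.mono (by lia)
  | index =>
    have h := Exec.loop_of_forall (k := Stack.z) (P := .seq (.pop .z fun a _ => a)
        (.seq (.push .t fun _ => ()) (.push .out fun _ => one)))
      (n := z) (c := 0) (fun j => store a i (List.replicate j one ++ o) r w x j y (z - j))
      (fun j hj => replicate_ne_nil hj) (by simp [store])
      fun j _ => Exec.seq exec_pop_z (Exec.seq exec_push_t exec_push_out)
    have h' := Exec.seq h exec_moveTZ
    simp only [Nat.sub_self, Nat.zero_add] at h'
    exact h'.mono (by lia)

/-- The text of a template. -/
def text (one : B) (n : ℕ) (a : Option A) (l : List (Piece A B)) : List B :=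
  l.flatMap (Piece.text one n a)

/-- Write the text of a template. -/
def emit (one : B) : List (Piece A B) → Program A B
  | [] => .skip
  | p :: l => .seq (emit one l) (p.emit one)

/-- The output is a stack, so the last piece has to be written first. -/
theorem exec_emit (one : B) (l : List (Piece A B)) : Exec (emit one l) (store a i o r w x 0 y z)
    (store a i (text one z a l ++ o) r w x 0 y z) (l.length * (2 * z + 2)) := by
  induction l with
  | nil => exact (Exec.skip _).mono (by lia)
  | cons p l ih =>
    have := Exec.seq ih (p.exec_emit one)
    rw [← List.append_assoc] at this
    exact this.mono (le_of_eq (by simp; ring))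

/-- A constant template. -/
def constant (c : List B) : List (Piece A B) := c.map fun b => .letter fun _ => b

@[simp]
theorem text_constant (one : B) (n : ℕ) (a : Option A) (c : List B) :
    text one n a (constant c) = c := by
  induction c with
  | nil => rfl
  | cons b c ih =>
    simp only [text, constant, List.map_cons, List.flatMap_cons] at ih ⊢
    rw [ih]
    rfl

/-- Write the template `y` times, for each value of the counter `z` and each letter of `word`. -/
def emitAll (one : B) (l : List (Piece A B)) : Program A B :=
  .loop .y (.seq (.pop .y fun a _ => a) (.seq (.pop .word fun _ b => b.join)
    (.seq (emit one l) (.seq (.push .z fun _ => ()) (.load fun _ => none)))))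

/-- As `y` counts down, `z` counts up and supplies the index. Each text lands in front of the
earlier ones, hence the descending order. Once `word` is exhausted, popping yields `none`, in
agreement with `v[j]?`. -/
theorem exec_emitAll (one : B) (l : List (Piece A B)) (v : List A) :
    Exec (emitAll one l) (store none i o r (v.map some) x 0 y 0)
      (store none i ((List.range y).reverse.flatMap (fun j => text one j v[j]? l) ++ o) r
        ((v.map some).drop y) x 0 0 y) (y * (l.length * (2 * y + 2) + 1) + 1) := by
  have h := Exec.loop_of_forall (k := Stack.y) (P := .seq (.pop .y fun a _ => a)
    (.seq (.pop .word fun _ b => b.join)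
    (.seq (emit one l) (.seq (.push .z fun _ => ()) (.load fun _ => none)))))
    (n := y) (c := l.length * (2 * y + 2)) (fun m => store none i
      ((List.range m).reverse.flatMap (fun j => text one j v[j]? l) ++ o) r
        ((v.map some).drop m) x 0 (y - m) m)
    (fun m hm => replicate_ne_nil hm) (by simp [store]) fun m hm => by
      have := Exec.seq exec_pop_y (Exec.seq (exec_pop_word (a := none) (i := i)
        (o := (List.range m).reverse.flatMap (fun j => text one j v[j]? l) ++ o) (r := r)
        (w := (v.map some).drop m) (x := x) (t := 0) (y := y - m - 1) (z := m))
        (Exec.seq (exec_emit one l) (Exec.seq exec_push_z exec_clear)))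
      -- The cost of a round depends on its index `m`; `loop_of_forall` needs a bound uniform in `m
      -- < y`.
      refine Exec.mono (m := l.length * (2 * m + 2)) ?_ (by gcongr)
      have hl : (List.drop m (List.map some v)).head?.join = v[m]? := by
        rw [List.head?_drop, List.getElem?_map]
        cases v[m]? <;> rfl
      rw [hl] at this
      convert this using 2
      · simp [List.range_succ]
      · simp
      · lia
      · simp
  unfold emitAll
  simpa using h

/-- Empty the stacks `x`, `z` and `word`. -/
def cleanUp : Program A B :=
  .seq (.loop .x (.pop .x fun a _ => a)) (.seq (.loop .z (.pop .z fun a _ => a))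
    (.loop .word (.seq (.pop .word fun _ b => b.join) (.load fun _ => none))))

theorem exec_cleanUp : Exec cleanUp (store none i o r w x t y z) (store none i o r [] 0 t y 0)
    (x + z + w.length + 3) := by
  have h₁ := Exec.loop_of_forall (k := Stack.x) (P := .pop .x fun a _ => a)
    (n := x) (c := 0) (fun j => store none i o r w (x - j) t y z)
    (fun j hj => replicate_ne_nil hj) (by simp [store]) fun j _ => exec_pop_x
  have h₂ := Exec.loop_of_forall (k := Stack.z) (P := .pop .z fun a _ => a)
    (n := z) (c := 0) (fun j => store none i o r w (x - x) t y (z - j))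
    (fun j hj => replicate_ne_nil hj) (by simp [store]) fun j _ => exec_pop_z
  have h₃ := Exec.loop_of_forall (k := Stack.word) (P := .seq (.pop .word fun _ b => b.join)
      (.load fun _ => none))
    (n := w.length) (c := 0) (fun j => store none i o r (w.drop j) (x - x) t y (z - z))
    (fun j hj => drop_ne_nil (by simpa using hj)) (List.drop_eq_nil_of_le (by simp)) fun j _ => by
      have := Exec.seq (exec_pop_word (a := none) (i := i) (o := o) (r := r) (w := w.drop j)
        (x := x - x) (t := t) (y := y) (z := z - z)) exec_clear
      simpa using this
  have := Exec.seq h₁ (Exec.seq h₂ h₃)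
  simp only [Nat.sub_self, List.drop_length] at this
  exact this.mono (by lia)

/-- Write `c₁`, then the template for all indices below `(n + 2) ^ k` in descending order, where `n`
is the length of the input, then `c₂`. -/
def generator (one : B) (k : ℕ) (c₁ c₂ : List B) (l : List (Piece A B)) : Program A B :=
  -- After reading, `x` is the input length, and two pushes make it `n + 2`; `y` starts at `1` for
  -- the power. The end `c₂` is written first because the output grows at its front.
  .seq readInput (.seq (.push .x fun _ => ()) (.seq (.push .x fun _ => ())
    (.seq (.push .y fun _ => ()) (.seq (powXY k) (.seq (emit one (constant c₂))
    (.seq (emitAll one l) (.seq (emit one (constant c₁)) cleanUp)))))))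

/-- The text written by `generator`. -/
def generated (one : B) (k : ℕ) (c₁ c₂ : List B) (l : List (Piece A B)) (w : List A) : List B :=
  c₁ ++ ((List.range ((w.length + 2) ^ k)).reverse.flatMap (fun j => text one j w[j]? l) ++ c₂)

/-- A bound on the running time of `generator`. -/
noncomputable def generatorTime (k m₁ m₂ m : ℕ) : Polynomial ℕ :=
  let x : Polynomial ℕ := Polynomial.X + 2
  let y : Polynomial ℕ := x ^ k
  (2 * Polynomial.X + 2) + ((k : Polynomial ℕ) * (y * (3 * x + 3) + 2) + (2 * (m₂ : Polynomial ℕ) +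
    ((y * ((m : Polynomial ℕ) * (2 * y + 2) + 1) + 1) +
    ((m₁ : Polynomial ℕ) * (2 * y + 2) + (x + y + Polynomial.X + 3)))))

theorem exec_generator (one : B) (k : ℕ) (c₁ c₂ : List B) (l : List (Piece A B)) (v : List A) :
    Exec (generator one k c₁ c₂ l) (store none v [] [] [] 0 0 0 0)
      (store none [] (generated one k c₁ c₂ l v) [] [] 0 0 0 0)
      ((generatorTime k c₁.length c₂.length l.length).eval v.length) := by
  have h := Exec.seq (exec_readInput (o := ([] : List B)) (t := 0) (y := 0) (z := 0) v)
    (Exec.seq exec_push_x (Exec.seq exec_push_x (Exec.seq exec_push_y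
      (Exec.seq (exec_powXY (Nat.succ_pos _) k) (Exec.seq (exec_emit one (constant c₂))
        (Exec.seq (exec_emitAll one l v) (Exec.seq (exec_emit one (constant c₁)) exec_cleanUp)))))))
  simp only [text_constant, List.append_nil] at h
  refine h.mono ?_
  simp only [generatorTime, Polynomial.eval_add, Polynomial.eval_mul, Polynomial.eval_pow,
    Polynomial.eval_X, Polynomial.eval_natCast, Polynomial.eval_ofNat, Polynomial.eval_one,
    constant, List.length_map, List.length_drop, Nat.succ_eq_add_one, add_assoc,
    Nat.reduceAdd]
  -- The letters that `emitAll` leaves on `word`, counted by a truncated difference.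
  have : v.length - (v.length + 2) ^ k ≤ v.length := Nat.sub_le _ _
  lia

/-- Texts that consist of a fixed beginning, instances of a template for polynomially many indices,
and a fixed end can be computed in polynomial time. -/
theorem generated_polyTime [Fintype A] (one : B) (k : ℕ) (c₁ c₂ : List B)
    (l : List (Piece A B)) {I : Type} (enc : I → List B) (f : List A → I)
    (hf : ∀ w, enc (f w) = generated one k c₁ c₂ l w) :
    Nonempty (TM2ComputableInPolyTime (id : List A → List A) enc f) := by
  let : Fintype (Stack.Alphabet A B .inp) := inferInstanceAs (Fintype A)
  have hi : ∀ v : List A, (store none v [] [] [] 0 0 0 0 : Store (Stack.Alphabet A B) (Option A)) =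
      (none, (update (fun _ => []) Stack.inp v : (k : Stack) → List (Stack.Alphabet A B k))) :=
    fun v => Prod.ext rfl (funext fun j => by cases j <;> rfl)
  have ho : ∀ v : List B, (store none [] v [] [] 0 0 0 0 : Store (Stack.Alphabet A B) (Option A)) =
      (none, (update (fun _ => []) Stack.out v : (k : Stack) → List (Stack.Alphabet A B k))) :=
    fun v => Prod.ext rfl (funext fun j => by cases j <;> rfl)
  refine ⟨{ tm := machine Stack.inp Stack.out none (generator one k c₁ c₂ l)
            inputAlphabet := Equiv.refl A
            outputAlphabet := Equiv.refl B
            time := generatorTime k c₁.length c₂.length l.length + 1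
            outputsFun := fun w => Classical.choice ?_ }⟩
  have h := exec_generator one k c₁ c₂ l w
  rw [hi, ho] at h
  have := machine_outputs Stack.inp Stack.out none _ _ _ _ _ h
  rw [← hf] at this
  -- The definition of computability passes both words through `List.map` of the alphabet
  -- equivalences, which are identities here; the run is transported along these equalities.
  have aux : ∀ w' u', w' = w → u' = enc (f w) → Nonempty (TM2OutputsInTime
      (machine Stack.inp Stack.out none (generator one k c₁ c₂ l)) w' (some u')
      ((generatorTime k c₁.length c₂.length l.length).eval w.length + 1)) := by
    rintro _ _ rfl rfl
    exact this
  rw [Polynomial.eval_add, Polynomial.eval_one]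
  exact aux _ _ (List.map_id w) (List.map_id _)

end StackProgram

/-! ### The query of the reduction and its word as an instance of a template. -/

namespace GPC

open Complexity StackProgram

/-! ### Templates for conditions -/

section Template

variable {A : Type}

/-- Words that are instances of one template, for all values of the index and all letters. -/
def IsTemplate (F : ℕ → Option A → List Token) : Prop :=
  ∃ l : List (Piece A Token), ∀ i a, text (.bit true) i a l = F i a

namespace IsTemplate

variable {F G : ℕ → Option A → List Token}

theorem const (c : List Token) : IsTemplate (fun (_ : ℕ) (_ : Option A) => c) :=
  ⟨constant c, fun i a => text_constant _ i a c⟩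

theorem append (hF : IsTemplate F) (hG : IsTemplate G) :
    IsTemplate fun i a => F i a ++ G i a := by
  obtain ⟨l, hl⟩ := hF
  obtain ⟨m, hm⟩ := hG
  exact ⟨l ++ m, fun i a => by simp [← hl, ← hm, text]⟩

theorem cons (b : Token) (hF : IsTemplate F) : IsTemplate fun i a => b :: F i a :=
  (const [b]).append hF

theorem index : IsTemplate (fun i (_ : Option A) => List.replicate i (.bit true)) :=
  ⟨[.index], fun i a => by simp [text, Piece.text]⟩

theorem map {T : Type} (l : List T) (f : T → Option A → Token) :
    IsTemplate fun (_ : ℕ) a => l.map fun b => f b a :=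
  ⟨l.map fun b => .letter (f b), fun i a => by
    induction l with
    | nil => rfl
    | cons b l ih =>
      simp only [text, List.map_cons, List.flatMap_cons] at ih ⊢
      rw [ih]
      rfl⟩

theorem flatMap {T : Type} (l : List T) {f : T → ℕ → Option A → List Token}
    (h : ∀ b, IsTemplate (f b)) : IsTemplate fun i a => l.flatMap fun b => f b i a := by
  induction l with
  | nil => exact const []
  | cons b l ih => simpa only [List.flatMap_cons] using (h b).append ih

end IsTemplate

/-- Names that are instances of one template. -/
def IsNameTemplate (s : ℕ → Option A → Name) : Prop := IsTemplate fun i a => encodeName (s i a)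

/-- Conditions that are instances of one template. -/
def IsConditionTemplate (θ : ℕ → Option A → Condition) : Prop :=
  IsTemplate fun i a => (θ i a).encode

theorem IsNameTemplate.const (s : Name) : IsNameTemplate (fun (_ : ℕ) (_ : Option A) => s) :=
  IsTemplate.const _

namespace IsConditionTemplate

variable {θ φ : ℕ → Option A → Condition} {a b : ℕ → Option A → Name}

theorem const (θ : Condition) : IsConditionTemplate (fun (_ : ℕ) (_ : Option A) => θ) :=
  IsTemplate.const _

theorem eqConst (v : Var) (ha : IsNameTemplate a) (hb : IsNameTemplate b) :
    IsConditionTemplate fun i c => .eqConst v (a i c) (b i c) :=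
  .cons _ (.append (.const _) (.append ha hb))

theorem eqProp (v u : Var) (ha : IsNameTemplate a) (hb : IsNameTemplate b) :
    IsConditionTemplate fun i c => .eqProp v (a i c) u (b i c) :=
  .cons _ (.append (.const _) (.append ha (.append (.const _) hb)))

theorem and (h₁ : IsConditionTemplate θ) (h₂ : IsConditionTemplate φ) :
    IsConditionTemplate fun i c => .and (θ i c) (φ i c) := .cons _ (.append h₁ h₂)

theorem or (h₁ : IsConditionTemplate θ) (h₂ : IsConditionTemplate φ) :
    IsConditionTemplate fun i c => .or (θ i c) (φ i c) := .cons _ (.append h₁ h₂)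

theorem not (h : IsConditionTemplate θ) : IsConditionTemplate fun i c => .not (θ i c) := .cons _ h

end IsConditionTemplate

end Template

/-! ### Names -/

/-- Natural numbers in unary. -/
def unary (i : ℕ) : Name := List.replicate i true

theorem unary_injective : Function.Injective unary := fun i j h => by
  simpa [unary] using congrArg List.length h

open Classical in
/-- Names of the same length for the elements of a finite type. -/
noncomputable def indicator {T : Type} [Fintype T] (q : T) : Name :=
  Finset.univ.toList.map fun b => decide (b = q)

/-- Two equal names agree at the position of `p`, where that of `p` has `true`. -/
theorem indicator_injective {T : Type} [Fintype T] : Function.Injective (indicator (T := T)) := by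
  intro p q h
  simpa [indicator] using List.map_inj_left.1 h p (by simp)

section NameTemplate

variable {A : Type}

theorem isNameTemplate_unary : IsNameTemplate fun i (_ : Option A) => unary i := by
  simpa [IsNameTemplate, encodeName, unary] using IsTemplate.index.append (.const [.terminator])

theorem isNameTemplate_unary_succ : IsNameTemplate fun i (_ : Option A) => unary (i + 1) :=
  .cons (.bit true) isNameTemplate_unary

/-- All indicator names have the same length, so each position is one letter that depends only on
the register. -/
theorem isNameTemplate_indicator {T : Type} [Fintype T] (g : Option A → T) :
    IsNameTemplate fun (_ : ℕ) a => indicator (g a) := by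
  classical
  refine IsTemplate.append ?_ (.const [.terminator])
  simp only [indicator, List.map_map]
  exact IsTemplate.map _ fun b a => .bit (decide (b = g a))

end NameTemplate

/-! ### Conditions for configurations of Turing machines -/

instance {A : Type} (M : TuringMachine A) : Fintype M.State := M.finState

instance {A : Type} (M : TuringMachine A) : Fintype M.Symbol := M.finSymbol

/-- The key for the state. -/
def stateKey : Key := [false]

/-- The key for the head position. -/
def headKey : Key := [false, false]

theorem unary_ne_stateKey (i : ℕ) : unary i ≠ stateKey := by
  rcases i with _ | i <;> simp [unary, stateKey, List.replicate_succ]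

theorem unary_ne_headKey (i : ℕ) : unary i ≠ headKey := by
  rcases i with _ | i <;> simp [unary, headKey, List.replicate_succ]

/-- The value for the state before the start of the computation. -/
def initialName : Const := []

/-- The value for the state after an accepting computation. -/
def acceptName : Const := [false]

/-- The values for the states of a machine. -/
noncomputable def stateName {T : Type} [Fintype T] (q : T) : Const := true :: indicator q

theorem stateName_injective {T : Type} [Fintype T] : Function.Injective (stateName (T := T)) :=
  fun _ _ h => indicator_injective (List.cons_injective h)

theorem stateName_ne_initialName {T : Type} [Fintype T] (q : T) : stateName q ≠ initialName := by
  simp [stateName, initialName]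

/-- The variable for the start of a path. -/
def varStart : Var := []

/-- The variable for the source of a step. -/
def varSrc : Var := [false]

/-- The variable for the target of a step. -/
def varTgt : Var := [true]

/-- The variable for the end of a path. -/
def varEnd : Var := [true, true]

/-- Implication. -/
def Condition.imp (θ φ : Condition) : Condition := .or (.not θ) φ

/-- The conjunction of `θ` and of a list of conditions. -/
def Condition.conj (θ : Condition) (l : List Condition) : Condition := l.foldr .and θ

/-- In prefix notation a right-nested conjunction is flat: every conjunct just follows its own
`and`. This is what allows long conjunctions to be written by repeating a template. -/
theorem Condition.encode_conj (θ : Condition) (l : List Condition) :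
    (θ.conj l).encode = l.flatMap (fun φ => .and :: φ.encode) ++ θ.encode := by
  induction l with
  | nil => rfl
  | cons φ l ih =>
    simp only [Condition.conj, List.foldr_cons, Condition.encode, List.flatMap_cons] at ih ⊢
    rw [ih]
    simp

theorem Condition.holds_conj (G : PropertyGraph) (μ : Assignment) (θ : Condition)
    (l : List Condition) : (θ.conj l).Holds G μ ↔ (∀ φ ∈ l, φ.Holds G μ) ∧ θ.Holds G μ := by
  induction l with
  | nil => simp [Condition.conj]
  | cons φ l ih =>
    simp only [Condition.conj, List.foldr_cons, Condition.Holds, List.forall_mem_cons] at ih ⊢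
    rw [ih, and_assoc]

theorem Condition.wellTyped_conj (s : Schema) (θ : Condition) (l : List Condition) :
    (θ.conj l).WellTyped s ↔ (∀ φ ∈ l, φ.WellTyped s) ∧ θ.WellTyped s := by
  induction l with
  | nil => simp [Condition.conj]
  | cons φ l ih =>
    simp only [Condition.conj, List.foldr_cons, Condition.WellTyped, List.forall_mem_cons] at ih ⊢
    rw [ih, and_assoc]

@[simp]
theorem Condition.holds_imp (G : PropertyGraph) (μ : Assignment) (θ φ : Condition) :
    (θ.imp φ).Holds G μ ↔ (θ.Holds G μ → φ.Holds G μ) := by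
  simp [Condition.imp, Condition.Holds, imp_iff_not_or]

section Conditions

variable {A : Type} (M : TuringMachine A)

/-- The head of the source is on cell `i` in state `q` and reads `b`. -/
noncomputable def reading (i : ℕ) (q : M.State) (b : M.Symbol) : Condition :=
  .and (.eqConst varSrc headKey (unary i))
    (.and (.eqConst varSrc stateKey (stateName q)) (.eqConst varSrc (unary i) (indicator b)))

/-- The head of the target is on cell `i`, the state is `q`, and cell `j` contains `b`. -/
noncomputable def written (i j : ℕ) (q : M.State) (b : M.Symbol) : Condition :=
  .and (.eqConst varTgt headKey (unary i))
    (.and (.eqConst varTgt stateKey (stateName q)) (.eqConst varTgt (unary j) (indicator b)))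

open Classical in
/-- The effect of the transition in state `q` reading `b`: moves to the left end in cell `i`, all
others begin there. -/
noncomputable def transitionCondition (i : ℕ) (q : M.State) (b : M.Symbol) : Condition :=
  match M.trans q b with
  | none =>
    if q ∈ M.accepting then (reading M i q b).imp (.eqConst varTgt stateKey acceptName)
    else .not (reading M i q b)
  -- Filed under the target cell, since a template can write `i + 1` as one more letter but has no
  -- predecessor of `i`. Moves to the left from cell `0` are covered by `leftmostCondition`.
  | some (q', b', .left) => (reading M (i + 1) q b).imp (written M i (i + 1) q' b')
  | some (q', b', .stay) => (reading M i q b).imp (written M i i q' b')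
  | some (q', b', .right) => (reading M i q b).imp (written M (i + 1) i q' b')

/-- The source is the start of the path. -/
def srcInitial : Condition := .eqConst varSrc stateKey initialName

/-- After the start, the machine is in its start state on cell `0`. -/
noncomputable def initialCondition : Condition :=
  srcInitial.imp (.and (.eqConst varTgt headKey (unary 0))
    (.eqConst varTgt stateKey (stateName M.start)))

/-- The effect of the transition in state `q` reading `b` on cell `0`, if it is a move to the
left. -/
noncomputable def leftmostCondition (q : M.State) (b : M.Symbol) : Condition :=
  match M.trans q b with
  | some (q', b', .left) => (reading M 0 q b).imp (written M 0 0 q' b')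
  -- There is no trivially true condition; one that belongs to the conjunction anyway takes its
  -- place.
  | _ => initialCondition M

/-- All states with all symbols. -/
noncomputable def stateSymbols : List (M.State × M.Symbol) := Finset.univ.toList

/-- The conditions about cell `i`, where `a` is the input letter in this cell. -/
noncomputable def cellConditions (i : ℕ) (a : Option A) : List Condition :=
  srcInitial.imp (.eqConst varTgt (unary i) (indicator (a.elim M.blank M.input))) ::
  -- Frame condition: away from the head the cell is copied.
  .or srcInitial (.or (.eqConst varSrc headKey (unary i))
    (.eqProp varSrc (unary i) varTgt (unary i))) ::
  (stateSymbols M).map fun p => transitionCondition M i p.1 p.2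

/-- The target is the successor of the source in a computation on the first `N` cells. -/
noncomputable def stepCondition (N : ℕ) (w : List A) : Condition :=
  (initialCondition M).conj ((List.range N).reverse.flatMap (fun i => cellConditions M i w[i]?) ++
    (stateSymbols M).map fun p => leftmostCondition M p.1 p.2)

theorem isConditionTemplate_eqHead (v : Var) :
    IsConditionTemplate fun i (_ : Option A) => .eqConst v headKey (unary i) :=
  .eqConst v (.const _) isNameTemplate_unary

theorem isConditionTemplate_eqHead_succ (v : Var) :
    IsConditionTemplate fun i (_ : Option A) => .eqConst v headKey (unary (i + 1)) :=
  .eqConst v (.const _) isNameTemplate_unary_succ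

theorem isConditionTemplate_eqCell (v : Var) (c : Const) :
    IsConditionTemplate fun i (_ : Option A) => .eqConst v (unary i) c :=
  .eqConst v isNameTemplate_unary (.const _)

theorem isConditionTemplate_eqCell_succ (v : Var) (c : Const) :
    IsConditionTemplate fun i (_ : Option A) => .eqConst v (unary (i + 1)) c :=
  .eqConst v isNameTemplate_unary_succ (.const _)

theorem isConditionTemplate_transition (q : M.State) (b : M.Symbol) :
    IsConditionTemplate fun i (_ : Option A) => transitionCondition M i q b := by
  have hr : IsConditionTemplate fun i (_ : Option A) => reading M i q b :=
    (isConditionTemplate_eqHead _).and (.and (.const _) (isConditionTemplate_eqCell _ _))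
  have hr' : IsConditionTemplate fun i (_ : Option A) => reading M (i + 1) q b :=
    (isConditionTemplate_eqHead_succ _).and (.and (.const _) (isConditionTemplate_eqCell_succ _ _))
  unfold transitionCondition
  rcases M.trans q b with _ | ⟨q', b', _ | _ | _⟩
  · dsimp only
    split
    · exact hr.not.or (.const _)
    · exact hr.not
  · exact hr'.not.or
      ((isConditionTemplate_eqHead _).and (.and (.const _) (isConditionTemplate_eqCell_succ _ _)))
  · exact hr.not.or
      ((isConditionTemplate_eqHead _).and (.and (.const _) (isConditionTemplate_eqCell _ _)))
  · exact hr.not.or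
      ((isConditionTemplate_eqHead_succ _).and (.and (.const _) (isConditionTemplate_eqCell _ _)))

/-- The number of conditions per cell depends only on `M`; the cell enters through unary names and
the input letter through an indicator name. -/
theorem isTemplate_cellConditions :
    IsTemplate fun i a => (cellConditions M i a).flatMap fun φ => .and :: φ.encode := by
  simp only [cellConditions, List.flatMap_cons, List.flatMap_map]
  refine .append (.cons _ ?_) (.append (.cons _ ?_) (.flatMap _ fun p => .cons _ ?_))
  · exact (IsConditionTemplate.const _).not.or
      (.eqConst _ isNameTemplate_unary (isNameTemplate_indicator _))
  · exact (IsConditionTemplate.const _).or ((isConditionTemplate_eqHead _).or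
      (.eqProp _ _ isNameTemplate_unary isNameTemplate_unary))
  · exact isConditionTemplate_transition M p.1 p.2

theorem wellTyped_stepCondition {s : Schema} (hx : s.Singleton varSrc) (hy : s.Singleton varTgt)
    (N : ℕ) (w : List A) : (stepCondition M N w).WellTyped s := by
  have hr : ∀ i q b, (reading M i q b).WellTyped s := fun i q b => ⟨hx, hx, hx⟩
  have hw : ∀ i j q b, (written M i j q b).WellTyped s := fun i j q b => ⟨hy, hy, hy⟩
  have hi : (initialCondition M).WellTyped s := ⟨hx, hy, hy⟩
  refine (Condition.wellTyped_conj _ _ _).2 ⟨?_, hi⟩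
  simp only [List.forall_mem_append, List.mem_flatMap, List.forall_mem_map, forall_exists_index,
    and_imp]
  constructor
  · intro φ i _ hφ
    simp only [cellConditions, List.mem_cons, List.mem_map] at hφ
    rcases hφ with rfl | rfl | ⟨⟨q, b⟩, _, rfl⟩
    · exact ⟨hx, hy⟩
    · exact ⟨hx, hx, hx, hy⟩
    · unfold transitionCondition
      dsimp only
      split
      · split
        · exact ⟨hr _ _ _, hy⟩
        · exact hr _ _ _
      all_goals exact ⟨hr _ _ _, hw _ _ _ _⟩
  · intro p _
    unfold leftmostCondition
    split
    · exact ⟨hr _ _ _, hw _ _ _ _⟩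
    · exact hi

end Conditions

/-! ### Queries for computations -/

section Queries

variable {A : Type} (M : TuringMachine A)

/-- The start of a path. -/
def startPattern : Pattern :=
  .cond (.node ⟨some varStart, none⟩) (.eqConst varStart stateKey initialName)

/-- A single edge. -/
def edgePattern : Pattern :=
  .concat (.node ⟨some varSrc, none⟩)
    (.concat (.edge .forward ⟨none, none⟩) (.node ⟨some varTgt, none⟩))

/-- A single computation step. -/
noncomputable def stepPattern (N : ℕ) (w : List A) : Pattern :=
  .cond edgePattern (stepCondition M N w)

/-- The end of a path. -/
def endPattern : Pattern :=
  .cond (.node ⟨some varEnd, none⟩) (.eqConst varEnd stateKey acceptName)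

/-- The accepting computations on the input `w` in the first `N` cells. -/
noncomputable def computationPattern (N : ℕ) (w : List A) : Pattern :=
  .concat startPattern (.concat (.rep (stepPattern M N w) 0 none) endPattern)

/-- The repetition gives `varSrc` and `varTgt` group types, which must not be shared. The four
variables are distinct and no concatenation shares any of them, so joinability is vacuous. -/
theorem wellTyped_computationPattern (N : ℕ) (w : List A) :
    (computationPattern M N w).WellTyped := by
  have h₁ : ∀ x : Var, x ≠ [false] → x ≠ [true] → edgePattern.sch x = none := by
    intro x h h'
    simp [edgePattern, Pattern.sch, varSrc, varTgt, h.symm, h'.symm]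
  refine ⟨⟨trivial, .node, by simp [Pattern.sch], .inl rfl⟩,
    ⟨⟨⟨trivial, ⟨trivial, trivial, ?_⟩, ?_⟩, wellTyped_stepCondition M ?_ ?_ N w⟩,
      ⟨trivial, .node, by simp [Pattern.sch], .inl rfl⟩, ?_⟩, ?_⟩
  · intro x τ₁ τ₂ h₁ h₂
    simp [Pattern.sch] at h₁
  · intro x τ₁ τ₂ h₁ h₂
    simp only [Pattern.sch, varSrc, varTgt] at h₁ h₂
    by_cases hx : x = [false] <;> simp_all
  · exact ⟨.node, by simp [edgePattern, Pattern.sch], .inl rfl⟩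
  · exact ⟨.node, by simp [edgePattern, Pattern.sch, varSrc, varTgt], .inl rfl⟩
  · intro x τ₁ τ₂ h₂ h₃
    simp only [Pattern.sch, stepPattern, endPattern, varEnd] at h₂ h₃
    by_cases hx : x = [true, true]
    · subst hx
      rw [h₁ _ (by simp) (by simp)] at h₂
      simp at h₂
    · simp [Ne.symm hx] at h₃
  · intro x τ₁ τ₂ h₂ h₃
    simp only [Pattern.sch, stepPattern, endPattern, varEnd, startPattern, varStart] at h₂ h₃
    by_cases hx : x = []
    · subst hx
      rw [h₁ _ (by simp) (by simp)] at h₃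
      simp at h₃
    · simp [Ne.symm hx] at h₂

/-- The beginning of the word for a query. -/
def textBefore (ρ : Restrictor) : List Token :=
  ρ.token :: .concat :: (startPattern.encode ++ .concat :: .rep :: .cond :: edgePattern.encode)

/-- The end of the word for a query. -/
noncomputable def textAfter : List Token :=
  ((stateSymbols M).map fun p => leftmostCondition M p.1 p.2).flatMap
    (fun φ => .and :: φ.encode) ++ ((initialCondition M).encode ++ ((encodeNumber 0 ++
      encodeOption encodeNumber none) ++ endPattern.encode))

/-- Puts the word into the shape of `generated`. Here it matters that the cells of `stepCondition`
are listed in descending order. -/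
theorem encode_computation (ρ : Restrictor) (N : ℕ) (w : List A) :
    (Query.path ρ (computationPattern M N w)).encode =
      textBefore ρ ++ ((List.range N).reverse.flatMap (fun i =>
        (cellConditions M i w[i]?).flatMap fun φ => .and :: φ.encode) ++ textAfter M) := by
  simp only [Query.encode, computationPattern, stepPattern, Pattern.encode, textBefore, textAfter,
    stepCondition, Condition.encode_conj, List.flatMap_append, List.flatMap_assoc,
    List.append_assoc, List.cons_append]

end Queries

end GPC

/-! ### Correctness: matches correspond to accepting computations. -/

namespace GPC

open Complexity StackProgram

section Semantics

variable {A : Type} {M : TuringMachine A} {G : PropertyGraph}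

theorem Path.tgt_append {p q : Path} (h : p.tgt = q.src) : (p.append q).tgt = q.tgt := by
  obtain ⟨s, l⟩ := p
  obtain ⟨s', l'⟩ := q
  rcases List.eq_nil_or_concat l' with rfl | ⟨l', e, rfl⟩
  · simpa [Path.tgt, Path.nodes, Path.append] using h
  · simp [Path.tgt, Path.nodes, Path.append]

theorem prop_of_eq_node {μ : Assignment} {x : Var} {u : Ident} (h : μ x = some (.node u))
    (k : Key) : μ.prop G x k = G.prop u k := by
  simp [Assignment.prop, h]

/-- The node `u` represents the first `N` cells and the head position of a configuration, with a
name for the state. -/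
structure Represents (G : PropertyGraph) (N : ℕ) (u : Ident) (s : Const)
    (c : Configuration M.State M.Symbol) : Prop where
  state : G.prop u stateKey = some s
  head : G.prop u headKey = some (unary c.head)
  tape : ∀ i < N, G.prop u (unary i) = some (indicator (c.tape i))

/-! #### From matches to computations -/

theorem holds_reading {μ : Assignment} {u N : ℕ} {q : M.State}
    {c : Configuration M.State M.Symbol} (hu : μ varSrc = some (.node u))
    (hr : Represents G N u (stateName q) c) (hN : c.head < N) :
    (reading M c.head q (c.tape c.head)).Holds G μ := by
  simp [reading, Condition.Holds, prop_of_eq_node hu, hr.state, hr.head, hr.tape _ hN]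

/-- What a node tells about the computation on the input `w`. -/
def Reached (M : TuringMachine A) (w : List A) (G : PropertyGraph) (N : ℕ) (u : Ident) : Prop :=
  G.prop u stateKey = some initialName ∨
    (∃ c, StateTransition.Reaches M.step (M.init w) c ∧ Represents G N u (stateName c.state) c) ∨
    M.Accepts w

/-- The conditions determine the target on all represented cells, and the space bound keeps the head
among them. Acceptance is an absorbing alternative, so nothing need be known about the path after
it. -/
theorem Reached.step {w : List A} {N u v : ℕ} {μ : Assignment}
    (hspace : ∀ c, StateTransition.Reaches M.step (M.init w) c → c.head < N)
    (hu : μ varSrc = some (.node u)) (hv : μ varTgt = some (.node v))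
    (hθ : (stepCondition M N w).Holds G μ) (h : Reached M w G N u) : Reached M w G N v := by
  obtain ⟨hl, hinit⟩ := (Condition.holds_conj _ _ _ _).1 hθ
  simp only [List.forall_mem_append, List.mem_flatMap, List.forall_mem_map, forall_exists_index,
    and_imp] at hl
  obtain ⟨hcell, hleft⟩ := hl
  replace hcell : ∀ i < N, ∀ φ ∈ cellConditions M i w[i]?, φ.Holds G μ :=
    fun i hi φ hφ => hcell φ i (by simpa using hi) hφ
  have hleft' : ∀ q b, (leftmostCondition M q b).Holds G μ :=
    fun q b => hleft (q, b) (by simp [stateSymbols])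
  have htrans : ∀ i < N, ∀ q b, (transitionCondition M i q b).Holds G μ := fun i hi q b =>
    hcell i hi _ (by
      simp only [cellConditions, List.mem_cons, List.mem_map]
      exact .inr (.inr ⟨(q, b), by simp [stateSymbols], rfl⟩))
  have hletter := fun i hi => hcell i hi _ List.mem_cons_self
  have hframe := fun i hi => hcell i hi _ (List.mem_cons_of_mem _ List.mem_cons_self)
  simp only [initialCondition, srcInitial, Condition.holds_imp, Condition.Holds,
    prop_of_eq_node hu, prop_of_eq_node hv] at hinit hletter hframe
  rcases h with h | ⟨c, hc, hr⟩ | h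
  · exact .inr (.inl ⟨_, .refl, (hinit h).2, (hinit h).1, fun i hi => hletter i hi h⟩)
  · have hN := hspace c hc
    have hread := holds_reading hu hr hN
    have hother : ∀ i < N, i ≠ c.head → G.prop v (unary i) = some (indicator (c.tape i)) := by
      intro i hi hne
      rcases hframe i hi with h | h | ⟨d, h, h'⟩
      · rw [hr.state, Option.some.injEq] at h
        exact absurd h (stateName_ne_initialName _)
      · rw [hr.head, Option.some.injEq] at h
        exact absurd (unary_injective h).symm hne
      · rw [hr.tape i hi] at h
        rw [h', h]
    have key : ∀ t, M.trans c.state (c.tape c.head) = some t →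
        (written M (t.2.2.apply c.head) c.head t.1 t.2.1).Holds G μ := by
      rintro ⟨q', b', m⟩ ht
      have h := htrans c.head hN c.state (c.tape c.head)
      rcases m with _ | _ | _
      -- A move to the left from cell `i + 1` is governed by the condition with index `i`, one from
      -- cell `0` by the leftmost condition.
      · rcases hh : c.head with _ | i
        · have h := hleft' c.state (c.tape c.head)
          simp only [leftmostCondition, ht, Condition.holds_imp] at h
          rw [hh] at h hread
          exact h hread
        · have h := htrans i (by lia) c.state (c.tape c.head)
          simp only [transitionCondition, ht, Condition.holds_imp] at h
          rw [hh] at h hread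
          exact h hread
      all_goals
        simp only [transitionCondition, ht, Condition.holds_imp] at h
        exact h hread
    rcases ht : M.trans c.state (c.tape c.head) with _ | t
    · refine .inr (.inr ⟨c, hc, by simp [TuringMachine.step, ht], ?_⟩)
      -- In a halting state that is not accepting, the condition forbids any outgoing step.
      by_contra hacc
      have h := htrans c.head hN c.state (c.tape c.head)
      simp only [transitionCondition, ht, hacc, if_false] at h
      exact h hread
    · have hw := key t ht
      simp only [written, Condition.Holds, prop_of_eq_node hv] at hw
      refine .inr (.inl ⟨⟨t.1, t.2.2.apply c.head, Function.update c.tape c.head t.2.1⟩,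
        hc.tail (by simp [TuringMachine.step, ht]), hw.2.1, hw.1, fun i hi => ?_⟩)
      dsimp only
      by_cases hi' : i = c.head
      · rw [hi', Function.update_self]
        exact hw.2.2
      · rw [Function.update_of_ne hi']
        exact hother i hi hi'
  · exact .inr (.inr h)

theorem mem_eval_stepPattern {N : ℕ} {w : List A} {p : Path} {μ : Assignment}
    (h : (p, μ) ∈ (stepPattern M N w).eval G) :
    μ varSrc = some (.node p.src) ∧ μ varTgt = some (.node p.tgt) ∧
      (stepCondition M N w).Holds G μ := by
  obtain ⟨⟨p₁, μ₁, p₂, μ₂, ⟨u, -, -, h₁⟩, ⟨p₃, μ₃, p₄, μ₄, ⟨e, -, -, h₃⟩, ⟨v, -, -, h₄⟩, h₃₄, -, h₂⟩,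
    h₁₂, -, h⟩, hθ⟩ := h
  simp only [Prod.mk.injEq] at h₁ h₂ h₃ h₄ h
  obtain ⟨rfl, rfl⟩ := h
  obtain ⟨rfl, rfl⟩ := h₁
  obtain ⟨rfl, rfl⟩ := h₂
  obtain ⟨rfl, rfl⟩ := h₃
  obtain ⟨rfl, rfl⟩ := h₄
  refine ⟨by simp [Assignment.union, Assignment.single, Path.append], ?_, hθ⟩
  rw [Path.tgt_append h₁₂, Path.tgt_append h₃₄]
  simp [Assignment.union, Assignment.single, Path.tgt, Path.nodes, varSrc, varTgt]

theorem Reached.power {N : ℕ} {w : List A}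
    (hspace : ∀ c, StateTransition.Reaches M.step (M.init w) c → c.head < N) (k : ℕ) :
    ∀ p l, (p, l) ∈ power G ((stepPattern M N w).eval G) k → Reached M w G N p.src →
      Reached M w G N p.tgt := by
  induction k with
  | zero =>
    rintro p l ⟨u, -, h⟩ hp
    simp only [Prod.mk.injEq] at h
    obtain ⟨rfl, rfl⟩ := h
    exact hp
  | succ k ih =>
    rintro p l ⟨p₁, μ, p₂, l₂, h₁, h₂, h₁₂, h⟩ hp
    simp only [Prod.mk.injEq] at h
    obtain ⟨rfl, rfl⟩ := h
    obtain ⟨hu, hv, hθ⟩ := mem_eval_stepPattern h₁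
    rw [Path.tgt_append h₁₂]
    refine ih _ _ h₂ ?_
    rw [← h₁₂]
    exact Reached.step hspace hu hv hθ hp

/-- The end node satisfies the invariant. Its state name differs from the initial one and from all
names of machine states, so only acceptance remains. -/
theorem accepts_of_mem_eval {N : ℕ} {w : List A}
    (hspace : ∀ c, StateTransition.Reaches M.step (M.init w) c → c.head < N)
    {r : Path × Assignment} (h : r ∈ (computationPattern M N w).eval G) : M.Accepts w := by
  obtain ⟨p₁, μ₁, p₂, μ₂, ⟨⟨u, -, -, h₁⟩, hs⟩, ⟨p₃, μ₃, p₄, μ₄, ⟨k, p, l, -, -, hl, h₃⟩,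
    ⟨⟨v, -, -, h₄⟩, ht⟩, h₃₄, -, h₂⟩, h₁₂, -, -⟩ := h
  simp only [Prod.mk.injEq] at h₁ h₂ h₃ h₄
  obtain ⟨rfl, rfl⟩ := h₁
  obtain ⟨rfl, rfl⟩ := h₂
  obtain ⟨rfl, rfl⟩ := h₃
  obtain ⟨rfl, rfl⟩ := h₄
  simp only [Condition.Holds, Assignment.prop, Assignment.single, if_true] at hs ht
  have hu : u = p₃.src := h₁₂
  have hv : p₃.tgt = v := h₃₄
  rcases Reached.power hspace k p₃ l hl (.inl (hu ▸ hs)) with h | ⟨c, -, hr⟩ | h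
  · rw [hv, ht] at h
    simp [acceptName, initialName] at h
  · have h := hr.state
    rw [hv, ht] at h
    simp [acceptName, stateName] at h
  · exact h

/-! #### From computations to matches -/

/-- A key has at most one value and all names are injective, so a represented node determines what
is read. -/
theorem holds_reading_iff {μ : Assignment} {u N i : ℕ} {q : M.State} {b : M.Symbol} {s : Const}
    {c : Configuration M.State M.Symbol} (hu : μ varSrc = some (.node u))
    (hr : Represents G N u s c) (hN : i < N) :
    (reading M i q b).Holds G μ ↔ i = c.head ∧ stateName q = s ∧ b = c.tape i := by
  simp only [reading, Condition.Holds, prop_of_eq_node hu, hr.state, hr.head, hr.tape _ hN,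
    Option.some.injEq, unary_injective.eq_iff, indicator_injective.eq_iff]
  tauto

/-- Consecutive names of states and configurations on a path for the computation on `w`. -/
inductive Successive (M : TuringMachine A) (w : List A) :
    Const → Configuration M.State M.Symbol → Const → Configuration M.State M.Symbol → Prop
  | initial : Successive M w initialName (M.init w) (stateName M.start) (M.init w)
  | step {c c'} : M.step c = some c' →
      Successive M w (stateName c.state) c (stateName c'.state) c'
  | accept {c} : M.step c = none → c.state ∈ M.accepting →
      Successive M w (stateName c.state) c acceptName c

/-- Nodes represent `N + 1` cells because the condition for moves to the left with index `i < N`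
mentions cell `i + 1`. If that cell were undefined in the target, the implication could fail. -/
theorem Successive.holds {w : List A} {N u v : ℕ} {μ : Assignment} {s s' : Const}
    {c c' : Configuration M.State M.Symbol} (h : Successive M w s c s' c')
    (hu : μ varSrc = some (.node u)) (hv : μ varTgt = some (.node v))
    (hr : Represents G (N + 1) u s c) (hr' : Represents G (N + 1) v s' c') :
    (stepCondition M N w).Holds G μ := by
  have hinit : (initialCondition M).Holds G μ := by
    simp only [initialCondition, srcInitial, Condition.holds_imp, Condition.Holds,
      prop_of_eq_node hu, prop_of_eq_node hv, hr.state, hr'.state, hr'.head, Option.some.injEq]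
    intro hs
    cases h with
    | initial => exact ⟨rfl, rfl⟩
    | step => exact absurd hs (stateName_ne_initialName _)
    | accept => exact absurd hs (stateName_ne_initialName _)
  -- Treats all moves at once. The position `j` is a separate variable so that both `i + 1` moving
  -- to `i` and the leftmost cell fit by `rfl`.
  have key : ∀ i < N + 1, ∀ q b, (reading M i q b).Holds G μ → ∀ t, M.trans q b = some t →
      ∀ j, j = t.2.2.apply i → (written M j i t.1 t.2.1).Holds G μ := by
    rintro i hi q b hread t ht j rfl
    obtain ⟨rfl, hs, rfl⟩ := (holds_reading_iff hu hr hi).1 hread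
    simp only [written, Condition.Holds, prop_of_eq_node hv, hr'.state, hr'.head, hr'.tape _ hi,
      Option.some.injEq]
    cases h with
    | initial => exact absurd hs (stateName_ne_initialName _)
    | step h =>
      obtain rfl := stateName_injective hs
      simp only [TuringMachine.step, ht, Option.map_some, Option.some.injEq] at h
      subst h
      exact ⟨rfl, rfl, by simp⟩
    | accept h =>
      obtain rfl := stateName_injective hs
      simp [TuringMachine.step, ht] at h
  refine (Condition.holds_conj _ _ _ _).2 ⟨?_, hinit⟩
  simp only [List.forall_mem_append, List.mem_flatMap, List.forall_mem_map, forall_exists_index,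
    and_imp, List.mem_reverse, List.mem_range]
  constructor
  · intro φ i hi hφ
    simp only [cellConditions, List.mem_cons, List.mem_map] at hφ
    rcases hφ with rfl | rfl | ⟨⟨q, b⟩, _, rfl⟩
    · simp only [srcInitial, Condition.holds_imp, Condition.Holds,
        prop_of_eq_node hu, prop_of_eq_node hv, hr.state, hr'.tape i (by lia), Option.some.injEq]
      intro hs
      cases h with
      | initial => rfl
      | step => exact absurd hs (stateName_ne_initialName _)
      | accept => exact absurd hs (stateName_ne_initialName _)
    · simp only [srcInitial, Condition.Holds, prop_of_eq_node hu, prop_of_eq_node hv, hr.state,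
        hr.head, hr.tape i (by lia), hr'.tape i (by lia), Option.some.injEq,
        unary_injective.eq_iff, exists_eq_left']
      cases h with
      | initial => exact .inl rfl
      | step h =>
        simp only [TuringMachine.step, Option.map_eq_some_iff] at h
        obtain ⟨t, -, rfl⟩ := h
        by_cases hi' : i = c.head
        · exact .inr (.inl hi'.symm)
        · exact .inr (.inr (by simp [hi']))
      | accept => exact .inr (.inr rfl)
    · rcases ht : M.trans q b with _ | ⟨q', b', _ | _ | _⟩ <;>
        simp only [transitionCondition, ht, Condition.holds_imp]
      · have aux : (reading M i q b).Holds G μ → q ∈ M.accepting ∧ s' = acceptName := by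
          intro hread
          obtain ⟨rfl, hs, rfl⟩ := (holds_reading_iff hu hr (by lia)).1 hread
          cases h with
          | initial => exact absurd hs (stateName_ne_initialName _)
          | step h =>
            obtain rfl := stateName_injective hs
            simp [TuringMachine.step, ht] at h
          | accept _ h =>
            obtain rfl := stateName_injective hs
            exact ⟨h, rfl⟩
        split
        · rw [Condition.holds_imp]
          intro hread
          simp [Condition.Holds, prop_of_eq_node hv, hr'.state, (aux hread).2]
        · next hacc => exact fun hread => hacc (aux hread).1
      · exact fun hread => key _ (by lia) q b hread _ ht _ rfl
      · exact fun hread => key _ (by lia) q b hread _ ht _ rfl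
      · exact fun hread => key _ (by lia) q b hread _ ht _ rfl
  · rintro ⟨q, b⟩ _
    rcases ht : M.trans q b with _ | ⟨q', b', _ | _ | _⟩ <;>
      simp only [leftmostCondition, ht, Condition.holds_imp]
    · exact hinit
    · exact fun hread => key _ (by lia) q b hread _ ht _ rfl
    · exact hinit
    · exact hinit

/-- The configuration after `j` steps, or the last one. -/
def configurationAt (M : TuringMachine A) (w : List A) (j : ℕ) : Configuration M.State M.Symbol :=
  (fun c => (M.step c).getD c)^[j] (M.init w)

theorem configurationAt_succ (M : TuringMachine A) (w : List A) (j : ℕ) :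
    configurationAt M w (j + 1) =
      (M.step (configurationAt M w j)).getD (configurationAt M w j) :=
  Function.iterate_succ_apply' _ _ _

/-- Replaces reachability by a numbered run, as needed to number the nodes of a chain. -/
theorem exists_configurationAt {w : List A} {c : Configuration M.State M.Symbol}
    (h : StateTransition.Reaches M.step (M.init w) c) :
    ∃ m, configurationAt M w m = c ∧
      ∀ j < m, M.step (configurationAt M w j) = some (configurationAt M w (j + 1)) := by
  induction h with
  | refl => exact ⟨0, rfl, fun j hj => absurd hj (Nat.not_lt_zero j)⟩
  | tail _ hs ih =>
    obtain ⟨m, rfl, hm⟩ := ih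
    have hs' : M.step (configurationAt M w m) = some _ := hs
    refine ⟨m + 1, by rw [configurationAt_succ, hs']; rfl, fun j hj => ?_⟩
    rcases Nat.lt_succ_iff_lt_or_eq.1 hj with hj | rfl
    · exact hm j hj
    · rw [configurationAt_succ, hs']; rfl

/-- The nodes `0, …, n` with edges from each one to the next, where each node carries the name of a
state and a configuration. -/
noncomputable def chain (n N : ℕ) (s : ℕ → Const) (c : ℕ → Configuration M.State M.Symbol) :
    PropertyGraph where
  nodes := Finset.range (n + 1)
  edges := Finset.Ico (n + 1) (n + 1 + n)
  disjoint := Finset.disjoint_left.2 fun i => by simp; lia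
  lab _ := ∅
  -- The edge from `j` to `j + 1` has the identifier `n + 1 + j`.
  src e := e - (n + 1)
  tgt e := e - n
  src_mem e := by simp; lia
  tgt_mem e := by simp; lia
  prop o k :=
    if o < n + 1 then
      if k = stateKey then some (s o)
      else if k = headKey then some (unary (c o).head)
      -- The length of a unary key is the index of its cell.
      else if k ∈ (Finset.range N).image unary then some (indicator ((c o).tape k.length))
      else none
    else none
  prop_dom o k h := by
    by_cases ho : o < n + 1
    · simp [ho]
    · simp [ho] at h
  prop_finite := by
    refine ((Finset.range (n + 1)) ×ˢ
      ({stateKey, headKey} ∪ (Finset.range N).image unary)).finite_toSet.subset ?_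
    rintro ⟨o, k⟩ h
    simp only [Set.mem_ofPred_eq] at h
    simp only [Finset.coe_product, Set.mem_prod, Finset.mem_coe, Finset.mem_range,
      Finset.mem_union, Finset.mem_insert, Finset.mem_singleton]
    by_cases ho : o < n + 1
    · refine ⟨ho, ?_⟩
      by_contra hk
      rw [not_or, not_or] at hk
      simp [ho, hk.1.1, hk.1.2] at h
      obtain ⟨i, hi, rfl⟩ := h
      exact hk.2 (Finset.mem_image_of_mem _ (Finset.mem_range.2 hi))
    · simp [ho] at h

theorem represents_chain {n N : ℕ} {s : ℕ → Const} {c : ℕ → Configuration M.State M.Symbol}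
    {o : ℕ} (ho : o < n + 1) : Represents (chain n N s c) N o (s o) (c o) where
  state := by simp only [chain, ho, if_true]
  head := by
    have : headKey ≠ stateKey := by simp [headKey, stateKey]
    simp only [chain, ho, if_true, this, if_false]
  tape i hi := by
    have : unary i ∈ (Finset.range N).image unary :=
      Finset.mem_image_of_mem _ (Finset.mem_range.2 hi)
    simp only [chain, ho, if_true, unary_ne_stateKey, unary_ne_headKey, if_false, this]
    simp [unary]

/-- The path with `k` edges from the node `o` on in a chain. -/
def chainPath (n o k : ℕ) : Path := ⟨o, (List.range' o k).map fun j => (n + 1 + j, j + 1)⟩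

theorem chainPath_succ (n o k : ℕ) :
    chainPath n o (k + 1) = (chainPath n o 1).append (chainPath n (o + 1) k) := by
  simp [chainPath, Path.append, List.range'_succ]

theorem nodes_chainPath (n o k : ℕ) : (chainPath n o k).nodes = List.range' o (k + 1) := by
  simp only [chainPath, Path.nodes, List.map_map, List.range'_succ]
  congr 1
  induction k generalizing o with
  | zero => rfl
  | succ k ih => simp [List.range'_succ, ih]

theorem edges_chainPath (n o k : ℕ) :
    (chainPath n o k).edges = (List.range' o k).map fun j => n + 1 + j := by
  simp [chainPath, Path.edges]

theorem tgt_chainPath (n o k : ℕ) : (chainPath n o k).tgt = o + k := by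
  simp [Path.tgt, nodes_chainPath, List.getLast_range']

/-- Induction on the number of edges for all starting nodes, since `power` splits off the first
match. -/
theorem power_chain {n N : ℕ} {w : List A} {s : ℕ → Const}
    {c : ℕ → Configuration M.State M.Symbol}
    (h : ∀ o < n, Successive M w (s o) (c o) (s (o + 1)) (c (o + 1))) (k : ℕ) :
    ∀ o, o + k ≤ n → ∃ l, (chainPath n o k, l) ∈
      power (chain n (N + 1) s c) ((stepPattern M N w).eval (chain n (N + 1) s c)) k := by
  induction k with
  | zero =>
    intro o ho
    exact ⟨[], o, by simp [chain]; lia, rfl⟩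
  | succ k ih =>
    intro o ho
    obtain ⟨l, hl⟩ := ih (o + 1) (by lia)
    have hs : (n + 1 + o) - (n + 1) = o := by lia
    have ht : (n + 1 + o) - n = o + 1 := by lia
    let μ₁ : Assignment := .single (some varSrc) (.node o)
    let μ₂ : Assignment := .single none (.edge (n + 1 + o))
    let μ₃ : Assignment := .single (some varTgt) (.node (o + 1))
    refine ⟨μ₁.union (μ₂.union μ₃) :: l, chainPath n o 1, μ₁.union (μ₂.union μ₃),
      chainPath n (o + 1) k, l, ⟨⟨⟨o, []⟩, μ₁, ⟨o, [(n + 1 + o, o + 1)]⟩, μ₂.union μ₃,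
      ⟨o, ?_, ?_, rfl⟩, ⟨⟨o, [(n + 1 + o, o + 1)]⟩, μ₂, ⟨o + 1, []⟩, μ₃, ⟨n + 1 + o, ?_, ?_, ?_⟩,
        ⟨o + 1, ?_, ?_, rfl⟩, rfl, ?_, rfl⟩, rfl, ?_, rfl⟩, ?_⟩, hl, ?_, ?_⟩
    · simp [chain]; lia
    · simp [Descriptor.LabelHolds]
    · simp [chain]; lia
    · simp [Descriptor.LabelHolds]
    · simp [chain, hs, ht, μ₂]
    · simp [chain]; lia
    · simp [Descriptor.LabelHolds]
    · intro x v₁ v₂ h₁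
      simp [μ₂, Assignment.single] at h₁
    · intro x v₁ v₂ h₁ h₂
      simp only [μ₁, μ₂, μ₃, Assignment.single, Assignment.union, varSrc, varTgt] at h₁ h₂
      by_cases hx : x = [false] <;> simp_all
    · refine (h o (by lia)).holds (u := o) (v := o + 1) ?_ ?_ (represents_chain (by lia))
        (represents_chain (by lia))
      · simp [μ₁, Assignment.single, Assignment.union, varSrc]
      · simp [μ₁, μ₂, μ₃, Assignment.single, Assignment.union, varSrc, varTgt]
    · rw [tgt_chainPath]; rfl
    · rw [chainPath_succ]

theorem mem_eval_computationPattern {n N : ℕ} {w : List A} {s : ℕ → Const}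
    {c : ℕ → Configuration M.State M.Symbol}
    (h : ∀ o < n, Successive M w (s o) (c o) (s (o + 1)) (c (o + 1)))
    (h₀ : s 0 = initialName) (hn : s n = acceptName) :
    ∃ μ, (chainPath n 0 n, μ) ∈ (computationPattern M N w).eval (chain n (N + 1) s c) := by
  obtain ⟨l, hl⟩ := power_chain (N := N) h n 0 (by lia)
  have hvars : (stepPattern M N w).vars = {varSrc, varTgt} := by
    ext x
    simp [stepPattern, edgePattern, Pattern.vars]
  let μ₁ : Assignment := .single (some varStart) (.node 0)
  let μ₂ : Assignment := .collect (stepPattern M N w).vars l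
  let μ₃ : Assignment := .single (some varEnd) (.node n)
  refine ⟨μ₁.union (μ₂.union μ₃), ⟨0, []⟩, μ₁, chainPath n 0 n, μ₂.union μ₃,
    ⟨⟨0, ?_, ?_, rfl⟩, ?_⟩, ⟨chainPath n 0 n, μ₂, ⟨n, []⟩, μ₃, ⟨n, _, l, Nat.zero_le _, ?_, hl, rfl⟩,
      ⟨⟨n, ?_, ?_, rfl⟩, ?_⟩, ?_, ?_, ?_⟩, rfl, ?_, ?_⟩
  · simp [chain]
  · simp [Descriptor.LabelHolds]
  · simp [μ₁, Condition.Holds, Assignment.prop, Assignment.single,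
      (represents_chain (n := n) (N := N + 1) (s := s) (c := c) (Nat.succ_pos n)).state, h₀]
  · simp
  · simp [chain]
  · simp [Descriptor.LabelHolds]
  · simp [μ₃, Condition.Holds, Assignment.prop, Assignment.single,
      (represents_chain (n := n) (N := N + 1) (s := s) (c := c) (Nat.lt_succ_self n)).state, hn]
  · rw [tgt_chainPath, Nat.zero_add]
  · intro x v₁ v₂ h₁ h₂
    simp only [μ₂, μ₃, Assignment.collect, Assignment.single, hvars, varSrc, varTgt, varEnd] at h₁ h₂
    by_cases hx : x = [true, true] <;> simp_all
  · simp [Path.append]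
  · intro x v₁ v₂ h₁ h₂
    simp only [μ₁, μ₂, μ₃, Assignment.collect, Assignment.single, Assignment.union, hvars,
      varSrc, varTgt, varEnd, varStart] at h₁ h₂
    by_cases hx : x = [] <;> simp_all
  · simp [Path.append, chainPath]

/-- A match of globally minimal length is also minimal for its own endpoints. -/
theorem exists_mem_shortest {S : Set (Path × Assignment)} (h : S.Nonempty) :
    (Restrictor.shortest.select S).Nonempty := by
  obtain ⟨r, hr, hmin⟩ := (measure fun r : Path × Assignment => r.1.length).wf.has_min S h
  exact ⟨r, hr, fun r' hr' _ _ => not_lt.1 (hmin r' hr')⟩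

/-- Restrictors only discard matches, which settles one direction; for the other, they leave at
least one match on the chain of an accepting run. -/
theorem satisfiable_iff_accepts (ρ : Restrictor) {N : ℕ} {w : List A}
    (hspace : ∀ c, StateTransition.Reaches M.step (M.init w) c → c.head < N) :
    (Query.path ρ (computationPattern M N w)).Satisfiable ↔ M.Accepts w := by
  constructor
  · rintro ⟨G, _, μ, ⟨p, hp⟩, _⟩
    refine accepts_of_mem_eval hspace (G := G) (r := (p, μ)) ?_
    cases ρ <;> exact hp.1
  · rintro ⟨_, hc, hhalt, hacc⟩
    obtain ⟨m, rfl, hm⟩ := exists_configurationAt hc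
    -- Node `0` is the artificial start, where `o - 1` truncates to the initial configuration. Nodes
    -- `1` to `m + 1` carry the run, and node `m + 2` repeats the last configuration under the
    -- accepting name.
    let c : ℕ → Configuration M.State M.Symbol := fun o =>
      if o ≤ m + 1 then configurationAt M w (o - 1) else configurationAt M w m
    let s : ℕ → Const := fun o => if o = 0 then initialName else
      if o ≤ m + 1 then stateName (configurationAt M w (o - 1)).state else acceptName
    have hsucc : ∀ o < m + 2, Successive M w (s o) (c o) (s (o + 1)) (c (o + 1)) := by
      intro o ho
      rcases o with _ | o
      · simpa [s, c, configurationAt, TuringMachine.init] using Successive.initial (M := M) (w := w)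
      · rcases Nat.lt_succ_iff_lt_or_eq.1 (Nat.lt_of_succ_lt_succ ho) with ho | rfl
        · have h₁ : o ≤ m := ho.le
          have h₂ : o + 1 ≤ m := ho
          simpa [s, c, h₁, h₂] using Successive.step (hm o ho)
        · simpa [s, c] using Successive.accept hhalt hacc
    obtain ⟨μ, hμ⟩ := mem_eval_computationPattern (N := N) hsucc (by simp [s]) (by simp [s])
    have hne : (ρ.select ((computationPattern M N w).eval (chain (m + 2) (N + 1) s c))).Nonempty := by
      cases ρ with
      | simple => exact ⟨_, hμ, by rw [nodes_chainPath]; exact List.nodup_range'⟩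
      | trail =>
        refine ⟨_, hμ, ?_⟩
        rw [edges_chainPath]
        exact List.Nodup.map (fun _ _ h => Nat.add_left_cancel h) List.nodup_range'
      | shortest => exact exists_mem_shortest ⟨_, hμ⟩
    obtain ⟨⟨p, ν⟩, hp⟩ := hne
    exact ⟨_, _, ν, ⟨p, hp⟩, rfl⟩

end Semantics

/-! ### The reduction -/

theorem exists_pow_bound (p : Polynomial ℕ) : ∃ k, ∀ n, p.eval n ≤ (n + 2) ^ k := by
  induction p using Polynomial.induction_on' with
  | add p q hp hq =>
    obtain ⟨k, hk⟩ := hp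
    obtain ⟨l, hl⟩ := hq
    -- The extra factor `n + 2 ≥ 2` absorbs the sum of two powers.
    refine ⟨max k l + 1, fun n => ?_⟩
    have h₁ := (hk n).trans (Nat.pow_le_pow_right (by lia) (le_max_left k l))
    have h₂ := (hl n).trans (Nat.pow_le_pow_right (by lia) (le_max_right k l))
    rw [Polynomial.eval_add, pow_succ]
    nlinarith [Nat.zero_le n, Nat.zero_le ((n + 2) ^ max k l)]
  | monomial d a =>
    refine ⟨a + d, fun n => ?_⟩
    rw [Polynomial.eval_monomial, pow_add]
    have : a ≤ (n + 2) ^ a :=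
      Nat.lt_two_pow_self.le.trans (Nat.pow_le_pow_left (by lia) a)
    gcongr
    lia

theorem pspaceHard_satisfiability (ρ : Restrictor) (C : Set Query)
    (hC : ∀ π, Query.path ρ π ∈ C) : PSPACEHard (satisfiability C) := by
  rintro A _ L ⟨M, p, hspace, -, hL⟩
  obtain ⟨k, hk⟩ := exists_pow_bound p
  obtain ⟨l, hl⟩ := isTemplate_cellConditions M
  let f : List A → Instances C := fun w =>
    ⟨.path ρ (computationPattern M ((w.length + 2) ^ k) w),
      wellTyped_computationPattern M _ w, hC _⟩
  refine ⟨f, generated_polyTime (.bit true) k (textBefore ρ) (textAfter M) l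
    (instanceEncoding C).encode f fun w => ?_, fun w => ?_⟩
  · simp only [generated, hl]
    exact encode_computation M ρ _ w
  · rw [← hL]
    exact (satisfiable_iff_accepts ρ fun c hc => (hspace w c hc).trans_le (hk _)).symm

end GPC

theorem mainTheorem3 :
    Complexity.PSPACEHard (GPC.satisfiability Set.univ) ∧
    ∀ ρ : GPC.Restrictor,
      Complexity.PSPACEHard (GPC.satisfiability {Q | ∃ π, Q = GPC.Query.path ρ π}) :=
  ⟨GPC.pspaceHard_satisfiability .simple _ fun _ => trivial,
    fun ρ => GPC.pspaceHard_satisfiability ρ _ fun π => ⟨π, rfl⟩⟩
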